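/- **Theorem 1.2.** Let $M\in GL(2,\mathbb Z)$ be hyperbolic (no eigenvalue of modulus $1$) with trace $r>0$ and determinant $\sigma=\pm1$, let $T$ be the automorphism of $\mathbb T^2=\mathbb R^2/\mathbb Z^2$ given by $M$, and let $\lambda=\frac12\bigl(r+\sqrt{r^2-4\sigma}\bigr)>1$. A point $t\in\mathbb T^2$ is *homoclinic* if $T^nt\to 0$ as $n\to\pm\infty$. Let $\widetilde{\mathfrak X}$ be the additive semigroup of all sequences $\varepsilon=(\varepsilon_n)_{n\in\mathbb Z}$ of nonnegative integers for which $\sum_{n\ge1}\varepsilon_n\lambda^{-n}$ and $\sum_{n\ge1}\varepsilon_{-n}\lambda^{-n}$ converge, with the weakest topology that makes all coordinates and both of these sums continuous, and let $(\tau\varepsilon)_n=\varepsilon_{n+1}$. A sequence is *finite* if it has only finitely many nonzero coordinates. An *arithmetic coding* of $T$ is a pair $(\varphi,\mathfrak X)$ such that * $\varphi:\widetilde{\mathfrak X}\to\mathbb T^2$ is a continuous semigroup homomorphism with $\varphi\tau=T\varphi$; * $\mathfrak X\subset\widetilde{\mathfrak X}$ is closed, satisfies $\tau\mathfrak X=\mathfrak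 X$, and is *total*: if $\varepsilon\in\mathfrak X$, $N\in\mathbb Z$, and $\varepsilon'\in\widetilde{\mathfrak X}$ is such that for every $k\in\mathbb Z$ the sequence $(\varepsilon'_{N+k},\varepsilon'_{N+k+1},\dots)$ is lexicographically less than or equal to $(\varepsilon_N,\varepsilon_{N+1},\dots)$, then $\varepsilon'\in\mathfrak X$; * $\varphi(\mathfrak X)=\mathbb T^2$, and $\varphi$ is injective on the set of finite sequences in $\mathfrak X$. Let $\mathfrak X_r$ be the Markov compactum of all $(\varepsilon_n)_{n\in\mathbb Z}$ with $\varepsilon_n\in\{0,\dots,r\}$ such that $\varepsilon_n=r$ implies $\varepsilon_{n+1}=0$, and let $\mathfrak Y_r$ be the sofic compactum of all $(\varepsilon_n)_{n\in\mathbb Z}$ with $\varepsilon_n\in\{0,\dots,r-1\}$ that contain no block $(r-1)(r-2)^s(r-1)$, $s\ge0$. **(I)** For each homoclinic point $t$ there is exactly one $w\in\mathbb R^2$ with $Mw=\lambda w$ and $w\equiv t \bmod\mathbb Z^2$ (the coordinates of $t$ in $\mathbb R^2$), and for each $\varepsilon\in\widetilde{\mathfrak X}$ the two-sided series in $$\varphi_t(\varepsilon)=\sum_{n=-\infty}^{\infty}\varepsilon_nT^{-n}t=\Bigl(\sum_{n=-\infty}^{\infty}\varepsilon_n\lambda^{-n}\Bigr)w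 \bmod\mathbb Z^2$$ converge in $\mathbb T^2$ (the partial sums over $-k\le n\le l$ converge as $k,l\to\infty$) to the same point. The map $t\mapsto\varphi_t$ is a bijection from the set of homoclinic points onto the set of continuous semigroup homomorphisms $\varphi:\widetilde{\mathfrak X}\to\mathbb T^2$ with $\varphi\tau=T\varphi$. If $t\ne0$, then $\varphi_t$ is surjective. Moreover, $t\mapsto(\varphi_t,\mathfrak X)$, where $\mathfrak X=\mathfrak X_r$ if $\sigma=-1$ and $\mathfrak X=\mathfrak Y_r$ if $\sigma=+1$, is a bijection from the set of nonzero homoclinic points onto the set of arithmetic codings of $T$. **(II)** If $(\varphi,\mathfrak X)$ is an arithmetic coding of $T$, then $\mathfrak X=\mathfrak X_r$ when $\sigma=-1$, and $\mathfrak X=\mathfrak Y_r$ when $\sigma=+1$. -/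

import Mathlib

open Filter Topology

noncomputable section

namespace ToralCoding

/-- The 2-torus `ℝ² / ℤ²`. -/
abbrev Torus : Type := UnitAddTorus (Fin 2)

/-- The projection `ℝ² → ℝ² / ℤ²`, that is, reduction modulo `ℤ²`. -/
def proj (w : Fin 2 → ℝ) : Torus := fun i => (w i : UnitAddCircle)

/-- The automorphism `T` of the torus given by the matrix `M ∈ GL(2, ℤ)`. -/
def toralAut (M : GL (Fin 2) ℤ) (x : Torus) : Torus := fun i => ∑ j, M.val i j • x j

/-- `T` acts on the torus as `M` acts on `ℝ²`. -/
theorem toralAut_proj (M : GL (Fin 2) ℤ) (w : Fin 2 → ℝ) :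
    toralAut M (proj w) = proj ((M.val.map (Int.cast : ℤ → ℝ)).mulVec w) := by
  funext i
  simp only [toralAut, proj, Matrix.mulVec, dotProduct, Matrix.map_apply, Fin.sum_univ_two,
    AddCircle.coe_add, ← zsmul_eq_mul, AddCircle.coe_zsmul]

theorem toralAut_one (x : Torus) : toralAut 1 x = x := by
  funext i
  fin_cases i <;> simp [toralAut]

/-- `toralAut (M ^ n)` is the `n`-th iterate (`n ∈ ℤ`) of `toralAut M`, because of this
and the preceding identity. -/
theorem toralAut_mul (M N : GL (Fin 2) ℤ) (x : Torus) :
    toralAut (M * N) x = toralAut M (toralAut N x) := by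
  funext i
  simp only [toralAut, Units.val_mul, Matrix.mul_apply, Fin.sum_univ_two, add_smul, mul_smul,
    smul_add]
  abel

/-- The trace `r` of `M`. -/
def tr (M : GL (Fin 2) ℤ) : ℤ := M.val.trace

/-- The determinant `σ` of `M`. -/
def dt (M : GL (Fin 2) ℤ) : ℤ := M.val.det

/-- Hyperbolicity: no eigenvalue of `M` lies on the unit circle. -/
def IsHyperbolic (M : GL (Fin 2) ℤ) : Prop :=
  ∀ z ∈ spectrum ℂ (M.val.map (Int.cast : ℤ → ℂ)), ‖z‖ ≠ 1

/-- The eigenvalue `(r + √(r² - 4σ)) / 2` of `M`; for hyperbolic `M` of positive trace it is the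
one that is greater than `1`. -/
def lam (M : GL (Fin 2) ℤ) : ℝ :=
  ((tr M : ℝ) + Real.sqrt ((tr M : ℝ) ^ 2 - 4 * (dt M : ℝ))) / 2

/-- A point of the torus is homoclinic to zero if `T ^ n t → 0` as `n → +∞` and as `n → -∞`. -/
def IsHomoclinic (M : GL (Fin 2) ℤ) (t : Torus) : Prop :=
  Tendsto (fun n : ℤ => toralAut (M ^ n) t) atTop (𝓝 0) ∧
    Tendsto (fun n : ℤ => toralAut (M ^ n) t) atBot (𝓝 0)

/-- The additive semigroup of the two-sided sequences of nonnegative integers such that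
`∑_{n ≥ 1} ε_n λ^{-n}` and `∑_{n ≥ 1} ε_{-n} λ^{-n}` converge. -/
def primarySubmonoid (M : GL (Fin 2) ℤ) : AddSubmonoid (ℤ → ℕ) where
  carrier := {e | Summable (fun n : ℕ => (e (n + 1) : ℝ) * ((lam M)⁻¹) ^ (n + 1)) ∧
    Summable (fun n : ℕ => (e (-(n + 1)) : ℝ) * ((lam M)⁻¹) ^ (n + 1))}
  zero_mem' := by simp [summable_zero]
  add_mem' := by
    rintro a b ⟨ha, ha'⟩ ⟨hb, hb'⟩
    refine ⟨(ha.add hb).congr fun n => ?_, (ha'.add hb').congr fun n => ?_⟩ <;>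
      simp [add_mul]

/-- The primary symbolic set, as a type of its own, so that it does not inherit the product
topology of `ℤ → ℕ`. -/
def PrimarySpace (M : GL (Fin 2) ℤ) : Type := primarySubmonoid M

variable {M : GL (Fin 2) ℤ}

instance : AddCommMonoid (PrimarySpace M) :=
  inferInstanceAs (AddCommMonoid (primarySubmonoid M))

/-- The sequence underlying a point of the primary symbolic set. -/
def PrimarySpace.seq (e : PrimarySpace M) : ℤ → ℕ := Subtype.val e

theorem PrimarySpace.seq_add (e e' : PrimarySpace M) : (e + e').seq = e.seq + e'.seq := rfl

/-- The sum `∑_{n ≥ 1} ε_n λ^{-n}`. -/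
def PrimarySpace.sumPos (e : PrimarySpace M) : ℝ :=
  ∑' n : ℕ, (e.seq (n + 1) : ℝ) * ((lam M)⁻¹) ^ (n + 1)

/-- The sum `∑_{n ≥ 1} ε_{-n} λ^{-n}`. -/
def PrimarySpace.sumNeg (e : PrimarySpace M) : ℝ :=
  ∑' n : ℕ, (e.seq (-(n + 1)) : ℝ) * ((lam M)⁻¹) ^ (n + 1)

/-- The natural weak topology of the primary symbolic set: the weakest one for which all the
coordinates and the sums of the two series are continuous. (For nonnegative sequences it is also
the topology of the weighted norm `∑ |ε_n| λ^{-|n|}`; on sequences with bounded digits it is the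
product topology.) -/
instance : TopologicalSpace (PrimarySpace M) :=
  TopologicalSpace.induced
    (fun e : PrimarySpace M => ((e.seq, e.sumPos, e.sumNeg) : (ℤ → ℕ) × ℝ × ℝ)) inferInstance

theorem shift_mem {e : ℤ → ℕ} (he : e ∈ primarySubmonoid M) :
    (fun n => e (n + 1)) ∈ primarySubmonoid M := by
  obtain ⟨h1, h2⟩ := he
  by_cases h0 : lam M = 0
  · constructor <;> simp [h0, summable_zero]
  refine ⟨?_, ?_⟩
  · refine (((summable_nat_add_iff 1).2 h1).mul_left (lam M)).congr fun n => ?_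
    push_cast
    rw [pow_succ _ (n + 1)]
    field_simp
  · rw [← summable_nat_add_iff 1]
    refine (h2.mul_left ((lam M)⁻¹)).congr fun n => ?_
    dsimp only
    rw [show (-(((n + 1 : ℕ) : ℤ) + 1) + 1 : ℤ) = -((n : ℤ) + 1) by push_cast; ring]
    ring

/-- The two-sided shift `τ`, `(τ ε)_n = ε_{n+1}`. -/
def shift (e : PrimarySpace M) : PrimarySpace M :=
  ⟨fun n => e.seq (n + 1), shift_mem (Subtype.property e)⟩

theorem shift_seq (e : PrimarySpace M) (n : ℤ) : (shift e).seq n = e.seq (n + 1) := rfl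

/-- Finite sequences: only finitely many coordinates are nonzero. -/
def finiteSeqs (M : GL (Fin 2) ℤ) : Set (PrimarySpace M) :=
  {e | (Function.support e.seq).Finite}

/-- The one-sided sequence `(ε_n, ε_{n+1}, …)`. -/
def tail (e : ℤ → ℕ) (n : ℤ) : ℕ → ℕ := fun k => e (n + k)

/-- `a` is lexicographically less than or equal to `b`. -/
def LexLE (a b : ℕ → ℕ) : Prop :=
  a = b ∨ ∃ n, (∀ m < n, a m = b m) ∧ a n < b n

/-- `X` is total: together with `ε` it contains each `ε'` all of whose tails are lexicographically
at most one fixed tail `(ε_N, ε_{N+1}, …)` of `ε`. -/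
def IsTotal (X : Set (PrimarySpace M)) : Prop :=
  ∀ e ∈ X, ∀ e' : PrimarySpace M,
    (∃ N : ℤ, ∀ k : ℤ, LexLE (tail e'.seq (N + k)) (tail e.seq N)) → e' ∈ X

/-- Continuous semigroup homomorphisms from the primary symbolic set to the torus that turn the
shift into `T`. -/
structure IsEquivariantHom (φ : PrimarySpace M → Torus) : Prop where
  continuous : Continuous φ
  map_add : ∀ e e', φ (e + e') = φ e + φ e'
  map_shift : ∀ e, φ (shift e) = toralAut M (φ e)

/-- Arithmetic codings `(φ, X)` of `T`. -/
structure IsArithmeticCoding (φ : PrimarySpace M → Torus) (X : Set (PrimarySpace M)) : Prop where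
  hom : IsEquivariantHom φ
  closed : IsClosed X
  shift_invariant : shift '' X = X
  total : IsTotal X
  surjective : φ '' X = Set.univ
  injective_on_finite : Set.InjOn φ (X ∩ finiteSeqs M)

/-- `φ_t(ε) = lim_{N → ∞} ∑_{n = -N}^{N} ε_n T^{-n} t`. -/
def codingMap (M : GL (Fin 2) ℤ) (t : Torus) (e : PrimarySpace M) : Torus :=
  limUnder atTop (fun N : ℕ =>
    ∑ n ∈ Finset.Icc (-(N : ℤ)) (N : ℤ), e.seq n • toralAut (M ^ (-n)) t)

/-- The coordinates in `ℝ²` of a homoclinic point `t`: the vector `w` of the expanding eigenline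
of `M` that represents `t` modulo `ℤ²`. -/
def IsPlanarCoordinates (M : GL (Fin 2) ℤ) (t : Torus) (w : Fin 2 → ℝ) : Prop :=
  (M.val.map (Int.cast : ℤ → ℝ)).mulVec w = lam M • w ∧ proj w = t

/-- The Markov compactum `X_r`: digits `0, …, r`, and a digit `r` is followed by `0`. -/
def markovCompactum (r : ℤ) : Set (ℤ → ℕ) :=
  {e | ∀ n, (e n : ℤ) ≤ r ∧ ((e n : ℤ) = r → e (n + 1) = 0)}

/-- The sofic compactum `Y_r`: digits `0, …, r - 1`, and no block
`(r-1)(r-2)^s(r-1)` with `s ≥ 0`. -/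
def soficCompactum (r : ℤ) : Set (ℤ → ℕ) :=
  {e | ∀ n, (e n : ℤ) ≤ r - 1 ∧
    ∀ s : ℕ, ¬ ((e n : ℤ) = r - 1 ∧ (∀ j : ℕ, 1 ≤ j → j ≤ s → (e (n + j) : ℤ) = r - 2) ∧
      (e (n + s + 1) : ℤ) = r - 1)}

/-- The symbolic compactum of `T`: `X_r` if `det M = -1` and `Y_r` otherwise. -/
def compactum (M : GL (Fin 2) ℤ) : Set (ℤ → ℕ) :=
  if dt M = -1 then markovCompactum (tr M) else soficCompactum (tr M)

end ToralCoding

end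

/-! Hyperbolicity makes `λ` irrational. If an orbit tends to zero, its small lifts eventually follow
`M` exactly, so a homoclinic `t` has a representative `w` on the expanding eigenline and a
representative `s` on the contracting one. Expressing the terms of `∑ ε_n T^{-n} t` with `n ≥ 0`
through `w` and those with `n < 0` through `s` gives convergence in the plane and a continuous `φ_t`
(`IsEigenRep.tendsto_sum`, `IsEigenRep.isEquivariantHom`). Conversely, an equivariant homomorphism
is determined by the image of the unit sequence at position 0, because finite sequences are dense.
That image is homoclinic because the shifted unit sequences tend to zero.

The symbolic part is Parry's theory of β-expansions. Let `a` be the quasi-greedy expansion of 1 in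
base `λ`: `r 0 r 0 …` for `σ = -1`, and `(r-1)(r-2)(r-2)…` for `σ = 1`. Both compacta consist of the
sequences all of whose tails are lexicographically at most `a` (`mem_compactum_iff`). Greedy
expansions show that the image of this set contains a half-line of the eigenline through `w`. The
half-line is dense and the image is compact, so the image is the whole torus. On finite admissible
sequences the value is strictly increasing in the lexicographic order, and for `t ≠ 0` the eigenline
injects into the torus, so `φ_t` is injective there.

Uniqueness of `X` has two halves. If some sequence of `X` contained a forbidden block, totality
would put into `X` two different finite sequences with equal images, by a carry identity of base
`λ`; hence `X` is contained in the compactum. If no sequence of `X` contained the first `m` digits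
of `a`, the values of its right halves would form a null set by self-similarity
(`IsCritical.volume_image_digitSum`), although surjectivity makes countably many translates of a
multiple of that set cover the line. So `X` matches arbitrarily long beginnings of `a`; totality
then yields all truncations of admissible sequences, and closedness yields all admissible sequences.
-/

namespace ToralCoding

/-! ### Expansions in a real base and lexicographic order -/

/-- The value `∑ b_k β^{-k-1}` of a one-sided digit sequence in base `β`. -/
noncomputable def digitSum (β : ℝ) (b : ℕ → ℕ) : ℝ := ∑' k, (b k : ℝ) * β⁻¹ ^ (k + 1)

/-- `a` is an expansion of `1` in base `β` that does not terminate and whose tails are expansions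
of numbers that are at most `1`. -/
structure IsCritical (β : ℝ) (a : ℕ → ℕ) : Prop where
  one_lt : 1 < β
  hasSum : HasSum (fun k => (a k : ℝ) * β⁻¹ ^ (k + 1)) 1
  tail_le : ∀ j, digitSum β (fun k => a (j + k)) ≤ 1
  zero_pos : 0 < a 0
  frequently_pos : ∀ N, ∃ j, N ≤ j ∧ 0 < a j

/-- All tails of the one-sided sequence `b` are lexicographically at most `a`. -/
def TailsLE (a b : ℕ → ℕ) : Prop :=
  ∀ n j, (∀ i < j, b (n + i) = a i) → b (n + j) ≤ a j

theorem TailsLE.drop {a b : ℕ → ℕ} (h : TailsLE a b) (m : ℕ) : TailsLE a (fun k => b (m + k)) := by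
  intro n j hj
  have := h (m + n) j (fun i hi => by rw [add_assoc]; exact hj i hi)
  rwa [add_assoc] at this

section
variable {β : ℝ} {a b : ℕ → ℕ}

theorem summable_digits (hβ : 1 < β) {C : ℕ} (hb : ∀ k, b k ≤ C) :
    Summable (fun k => (b k : ℝ) * β⁻¹ ^ (k + 1)) := by
  have h0 : 0 ≤ β⁻¹ := by positivity
  have hg : Summable (fun k : ℕ => (C : ℝ) * β⁻¹ ^ (k + 1)) :=
    ((summable_nat_add_iff 1).2
      (summable_geometric_of_lt_one h0 (inv_lt_one_of_one_lt₀ hβ))).mul_left _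
  refine Summable.of_nonneg_of_le (fun k => by positivity) (fun k => ?_) hg
  have : (b k : ℝ) ≤ C := by exact_mod_cast hb k
  gcongr

theorem summable_digits_of_eventually_zero {N : ℕ} (hb : ∀ k, N ≤ k → b k = 0) :
    Summable (fun k => (b k : ℝ) * β⁻¹ ^ (k + 1)) :=
  summable_of_ne_finset_zero (s := Finset.range N) fun k hk => by
    simp [hb k (by simpa using hk)]

theorem digitSum_nonneg (hβ : 1 < β) : 0 ≤ digitSum β b :=
  tsum_nonneg fun k => by positivity

theorem digitSum_split (hb : Summable (fun k => (b k : ℝ) * β⁻¹ ^ (k + 1))) (j : ℕ) :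
    digitSum β b = ∑ i ∈ Finset.range j, (b i : ℝ) * β⁻¹ ^ (i + 1) +
      β⁻¹ ^ j * digitSum β (fun k => b (j + k)) := by
  rw [digitSum, ← hb.sum_add_tsum_nat_add j, digitSum, ← tsum_mul_left]
  congr 2
  ext k
  rw [add_comm j k]
  ring

theorem digitSum_split_succ (hb : Summable (fun k => (b k : ℝ) * β⁻¹ ^ (k + 1))) (j : ℕ) :
    digitSum β b = ∑ i ∈ Finset.range j, (b i : ℝ) * β⁻¹ ^ (i + 1) +
      (b j + digitSum β (fun k => b (j + 1 + k))) * β⁻¹ ^ (j + 1) := by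
  rw [digitSum_split hb (j + 1), Finset.sum_range_succ]
  ring

theorem IsCritical.digitSum_eq (ha : IsCritical β a) : digitSum β a = 1 := ha.hasSum.tsum_eq

theorem IsCritical.pos (ha : IsCritical β a) : 0 < β := zero_lt_one.trans ha.one_lt

/-- The inequality is strict because a positive digit of `a` always follows. This is what later
gives strict comparison of values and a contraction ratio below 1. -/
theorem IsCritical.sum_lt_one (ha : IsCritical β a) (m : ℕ) :
    ∑ i ∈ Finset.range m, (a i : ℝ) * β⁻¹ ^ (i + 1) < 1 := by
  have hβ := ha.pos
  obtain ⟨j, hj, hpos⟩ := ha.frequently_pos m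
  have h1 : ∑ i ∈ Finset.range (j + 1), (a i : ℝ) * β⁻¹ ^ (i + 1) ≤ 1 :=
    sum_le_hasSum _ (fun i _ => by positivity) ha.hasSum
  have h2 : ∑ i ∈ Finset.range m, (a i : ℝ) * β⁻¹ ^ (i + 1) ≤
      ∑ i ∈ Finset.range j, (a i : ℝ) * β⁻¹ ^ (i + 1) :=
    Finset.sum_le_sum_of_subset_of_nonneg (by simpa using hj) fun i _ _ => by positivity
  have h3 : 0 < (a j : ℝ) * β⁻¹ ^ (j + 1) := by positivity
  rw [Finset.sum_range_succ] at h1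
  linarith

/-- A sequence that is lexicographically at most `a` and differs from `a` has a first difference,
and it is downward. -/
theorem exists_first_lt {b : ℕ → ℕ} {J : ℕ} (hb : ∀ j, (∀ i < j, b i = a i) → b j ≤ a j)
    (hJ : b J ≠ a J) : ∃ j ≤ J, (∀ i < j, b i = a i) ∧ b j < a j := by
  classical
  have hex : ∃ j, b j ≠ a j := ⟨J, hJ⟩
  have hlt : ∀ i < Nat.find hex, b i = a i := fun i hi => not_not.1 (Nat.find_min hex hi)
  exact ⟨Nat.find hex, Nat.find_min' hex hJ, hlt,
    lt_of_le_of_ne (hb _ hlt) (Nat.find_spec hex)⟩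

/-- At its first departure from `a` the word loses at least one unit in that place, and by induction
the remaining shorter word is worth less than that unit. -/
theorem IsCritical.digitSum_lt_one (ha : IsCritical β a) {N : ℕ} {b : ℕ → ℕ}
    (hN : ∀ k, N ≤ k → b k = 0) (hb : TailsLE a b) : digitSum β b < 1 := by
  induction N using Nat.strong_induction_on generalizing b with
  | _ N ih =>
    rcases Nat.eq_zero_or_pos N with rfl | hpos
    · simp [digitSum, fun k => hN k (Nat.zero_le k)]
    have hβ := ha.pos
    obtain ⟨J, hJ, haJ⟩ := ha.frequently_pos N
    obtain ⟨j, -, hlt, hj⟩ := exists_first_lt (a := a) (b := b) (J := J)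
      (fun j h => by simpa using hb 0 j (by simpa using h)) (by rw [hN J hJ]; exact haJ.ne)
    have htail : digitSum β (fun k => b (j + 1 + k)) < 1 := by
      refine ih (N - (j + 1)) (by omega) (fun k hk => hN _ (by omega)) (hb.drop _)
    rw [digitSum_split_succ (summable_digits_of_eventually_zero hN) j]
    have h1 : ∑ i ∈ Finset.range j, (b i : ℝ) * β⁻¹ ^ (i + 1) =
        ∑ i ∈ Finset.range j, (a i : ℝ) * β⁻¹ ^ (i + 1) :=
      Finset.sum_congr rfl fun i hi => by rw [hlt i (Finset.mem_range.1 hi)]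
    have h2 := ha.sum_lt_one (j + 1)
    rw [Finset.sum_range_succ] at h2
    have h3 : ((b j : ℝ) + digitSum β (fun k => b (j + 1 + k))) * β⁻¹ ^ (j + 1) ≤
        a j * β⁻¹ ^ (j + 1) := by
      have : (b j : ℝ) + 1 ≤ a j := by exact_mod_cast hj
      gcongr
      linarith
    linarith

/-- The larger digit wins one unit at the first difference, and the tail of `b` is worth less than a
unit. Only the smaller sequence has to be admissible. -/
theorem IsCritical.digitSum_lt_of_lt (ha : IsCritical β a) {N : ℕ} {b b' : ℕ → ℕ}
    (hN : ∀ k, N ≤ k → b k = 0) (hN' : ∀ k, N ≤ k → b' k = 0) (hb : TailsLE a b) {j : ℕ}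
    (hlt : ∀ i < j, b i = b' i) (hj : b j < b' j) : digitSum β b < digitSum β b' := by
  have hβ := ha.pos
  rw [digitSum_split_succ (summable_digits_of_eventually_zero hN) j,
    digitSum_split_succ (summable_digits_of_eventually_zero hN') j]
  have h1 : ∑ i ∈ Finset.range j, (b i : ℝ) * β⁻¹ ^ (i + 1) =
      ∑ i ∈ Finset.range j, (b' i : ℝ) * β⁻¹ ^ (i + 1) :=
    Finset.sum_congr rfl fun i hi => by rw [hlt i (Finset.mem_range.1 hi)]
  rw [h1]
  have h2 := ha.digitSum_lt_one (N := N) (b := fun k => b (j + 1 + k))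
    (fun k hk => hN _ (by omega)) (hb.drop _)
  have h3 := digitSum_nonneg (b := fun k => b' (j + 1 + k)) ha.one_lt
  have : (b j : ℝ) + 1 ≤ b' j := by exact_mod_cast hj
  gcongr ?_ + ?_ * _
  linarith

theorem IsCritical.digitSum_injective (ha : IsCritical β a) {N : ℕ} {b b' : ℕ → ℕ}
    (hN : ∀ k, N ≤ k → b k = 0) (hN' : ∀ k, N ≤ k → b' k = 0) (hb : TailsLE a b)
    (hb' : TailsLE a b') (h : digitSum β b = digitSum β b') : b = b' := by
  classical
  by_contra hne
  have hex : ∃ j, b j ≠ b' j := by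
    by_contra! hall
    exact hne (funext hall)
  have hlt : ∀ i < Nat.find hex, b i = b' i := fun i hi => not_not.1 (Nat.find_min hex hi)
  rcases lt_or_gt_of_ne (Nat.find_spec hex) with hj | hj
  · exact (ha.digitSum_lt_of_lt hN hN' hb hlt hj).ne h
  · exact (ha.digitSum_lt_of_lt hN' hN hb' (fun i hi => (hlt i hi).symm) hj).ne h.symm

theorem eq_sum_of_remainders (hβ : 0 < β) {y : ℕ → ℝ} {d : ℕ → ℕ}
    (hstep : ∀ k, β * y k = d k + y (k + 1)) (n j : ℕ) :
    y n = ∑ i ∈ Finset.range j, (d (n + i) : ℝ) * β⁻¹ ^ (i + 1) + y (n + j) * β⁻¹ ^ j := by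
  induction j with
  | zero => simp
  | succ j ih =>
    rw [Finset.sum_range_succ, ih, ← add_assoc n j 1]
    have : y (n + j) = β⁻¹ * (d (n + j) + y (n + j + 1)) := by
      rw [← hstep]; field_simp
    rw [this]
    ring

/-- Digits produced by the recursion `β y_k = d_k + y_{k+1}` with remainders in `[0, 1]` expand
the remainders. -/
theorem hasSum_of_remainders (hβ : 1 < β) {y : ℕ → ℝ} {d : ℕ → ℕ} (h0 : ∀ k, 0 ≤ y k)
    (h1 : ∀ k, y k ≤ 1) (hstep : ∀ k, β * y k = d k + y (k + 1)) (n : ℕ) :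
    HasSum (fun k => (d (n + k) : ℝ) * β⁻¹ ^ (k + 1)) (y n) := by
  have hpos : 0 < β := zero_lt_one.trans hβ
  rw [hasSum_iff_tendsto_nat_of_nonneg (fun k => by positivity)]
  have hlim : Tendsto (fun j => y n - y (n + j) * β⁻¹ ^ j) atTop (𝓝 (y n - 0)) :=
    tendsto_const_nhds.sub <| squeeze_zero (fun j => mul_nonneg (h0 _) (by positivity))
      (fun j => mul_le_of_le_one_left (by positivity) (h1 _))
      (tendsto_pow_atTop_nhds_zero_of_lt_one (inv_nonneg.2 hpos.le) (inv_lt_one_of_one_lt₀ hβ))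
  rw [sub_zero] at hlim
  refine hlim.congr fun j => ?_
  have := eq_sum_of_remainders hpos hstep n j
  linarith

/-- Greedy expansions. -/
theorem IsCritical.exists_expansion (ha : IsCritical β a) {x : ℝ} (hx0 : 0 ≤ x) (hx1 : x < 1) :
    ∃ b : ℕ → ℕ, TailsLE a b ∧ HasSum (fun k => (b k : ℝ) * β⁻¹ ^ (k + 1)) x := by
  have hβ := ha.pos
  set f : ℝ → ℝ := fun y => Int.fract (β * y) with hf
  set y : ℕ → ℝ := fun k => f^[k] x with hy
  set d : ℕ → ℕ := fun k => ⌊β * y k⌋₊ with hd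
  have hysucc : ∀ k, y (k + 1) = Int.fract (β * y k) := fun k => by
    simp only [hy, Function.iterate_succ_apply', hf]
  have hy0 : ∀ k, 0 ≤ y k ∧ y k < 1 := by
    intro k
    cases k with
    | zero => exact ⟨hx0, hx1⟩
    | succ k => rw [hysucc]; exact ⟨Int.fract_nonneg _, Int.fract_lt_one _⟩
  have hstep : ∀ k, β * y k = d k + y (k + 1) := by
    intro k
    have h0 : 0 ≤ β * y k := mul_nonneg hβ.le (hy0 k).1
    rw [hysucc]
    have : ((d k : ℕ) : ℝ) = (⌊β * y k⌋ : ℝ) := natCast_floor_eq_intCast_floor h0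
    rw [this, Int.floor_add_fract]
  refine ⟨d, ?_, ?_⟩
  -- A first digit above `a` would make the remainder at least the value of `a`, since the tail of
  -- `a` is worth at most one unit of the place `j`. But the remainder is below 1.
  · intro n j hlt
    by_contra! hj
    have h1 := eq_sum_of_remainders hβ hstep n (j + 1)
    rw [Finset.sum_range_succ, Finset.sum_congr rfl (fun i hi => by
      rw [hlt i (Finset.mem_range.1 hi)] :
        ∀ i ∈ Finset.range j, (d (n + i) : ℝ) * β⁻¹ ^ (i + 1) = (a i : ℝ) * β⁻¹ ^ (i + 1))] at h1
    have h2 := ha.digitSum_eq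
    rw [digitSum_split_succ ha.hasSum.summable j] at h2
    have h3 : ((a j : ℝ) + digitSum β (fun k => a (j + 1 + k))) * β⁻¹ ^ (j + 1) ≤
        d (n + j) * β⁻¹ ^ (j + 1) := by
      have h4 : (a j : ℝ) + 1 ≤ d (n + j) := by exact_mod_cast hj
      have := ha.tail_le (j + 1)
      gcongr
      linarith
    have h5 : 0 ≤ y (n + (j + 1)) * β⁻¹ ^ (j + 1) := mul_nonneg (hy0 _).1 (by positivity)
    have := (hy0 n).2
    linarith
  · have hx : y 0 = x := rfl
    simpa [hx] using hasSum_of_remainders ha.one_lt (fun k => (hy0 k).1)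
      (fun k => (hy0 k).2.le) hstep 0

theorem isCritical_of_remainders (hβ : 1 < β) {y : ℕ → ℝ} (h0 : ∀ k, 0 ≤ y k)
    (h1 : ∀ k, y k ≤ 1) (hstep : ∀ k, β * y k = a k + y (k + 1)) (hy : y 0 = 1)
    (ha0 : 0 < a 0) (hpos : ∀ N, ∃ j, N ≤ j ∧ 0 < a j) : IsCritical β a where
  one_lt := hβ
  hasSum := by simpa [hy] using hasSum_of_remainders hβ h0 h1 hstep 0
  tail_le j := (hasSum_of_remainders hβ h0 h1 hstep j).tsum_eq.trans_le (h1 j)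
  zero_pos := ha0
  frequently_pos := hpos

/-- The remainders alternate between `1` and `β⁻¹`, because `β = r + β⁻¹`. -/
theorem isCritical_markov {r : ℕ} (hβ : 1 < β) (hr : 0 < r) (h : β ^ 2 = r * β + 1) :
    IsCritical β (fun j => if Even j then r else 0) := by
  have hpos : 0 < β := zero_lt_one.trans hβ
  refine isCritical_of_remainders hβ (y := fun j => if Even j then 1 else β⁻¹) (fun k => ?_)
    (fun k => ?_) (fun k => ?_) (by simp) (by simpa) fun N => ⟨2 * N, by omega, by simpa⟩
  · split_ifs <;> positivity
  · split_ifs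
    · rfl
    · exact (inv_lt_one_of_one_lt₀ hβ).le
  · by_cases hk : Even k
    · have hk' : ¬ Even (k + 1) := by rwa [Nat.even_add_one, not_not]
      simp only [hk, hk', if_true, if_false]
      field_simp
      linear_combination h
    · have hk' : Even (k + 1) := by rwa [Nat.even_add_one]
      simp only [hk, hk', if_true, if_false]
      field_simp
      simp

/-- After the digit `r - 1` the remainder `β - (r - 1)` reproduces itself with the digit `r - 2`,
because `β² = rβ - 1`. -/
theorem isCritical_sofic {r : ℕ} (hβ : 1 < β) (hr : 3 ≤ r) (h : β ^ 2 = r * β - 1) :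
    IsCritical β (fun j => if j = 0 then r - 1 else r - 2) := by
  have hpos : 0 < β := zero_lt_one.trans hβ
  have h1 : ((r - 1 : ℕ) : ℝ) = r - 1 := by rw [Nat.cast_sub (by omega)]; simp
  have h2 : ((r - 2 : ℕ) : ℝ) = r - 2 := by rw [Nat.cast_sub (by omega)]; simp
  refine isCritical_of_remainders hβ (y := fun j => if j = 0 then 1 else β - (r - 1))
    (fun k => ?_) (fun k => ?_) (fun k => ?_) (by simp) (by simp; omega)
    fun N => ⟨N + 1, by omega, by simp; omega⟩
  · split_ifs
    · exact zero_le_one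
    · nlinarith
  · split_ifs
    · rfl
    · nlinarith
  · rcases Nat.eq_zero_or_pos k with rfl | hk
    · simp [h1]
    · simp only [hk.ne', if_false, Nat.succ_ne_zero, h2]
      linear_combination h

open MeasureTheory Pointwise in
/-- The values of the sequences each of whose tails drops below `a` within a bounded number of
steps form a null set. -/
theorem IsCritical.volume_image_digitSum (ha : IsCritical β a) (m : ℕ) :
    volume (digitSum β '' {b | ∀ n, ∃ j < m, (∀ i < j, b (n + i) = a i) ∧ b (n + j) < a j}) =
      0 := by
  have hβ := ha.pos
  set S := {b : ℕ → ℕ | ∀ n, ∃ j < m, (∀ i < j, b (n + i) = a i) ∧ b (n + j) < a j} with hS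
  set E := digitSum β '' S with hE
  have hbd : ∀ b ∈ S, ∀ n, b n ≤ a 0 := by
    intro b hb n
    obtain ⟨j, -, h1, h2⟩ := hb n
    rcases Nat.eq_zero_or_pos j with rfl | hj
    · exact h2.le
    · exact (h1 0 hj).le
  have hfin : volume E ≠ ⊤ := by
    have hsub : E ⊆ Set.Icc 0 (digitSum β fun _ => a 0) := by
      rintro _ ⟨b, hb, rfl⟩
      refine ⟨digitSum_nonneg ha.one_lt, ?_⟩
      refine (summable_digits ha.one_lt (hbd b hb)).tsum_le_tsum (fun k => ?_)
        (summable_digits ha.one_lt (fun _ => le_rfl))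
      have : (b k : ℝ) ≤ a 0 := by exact_mod_cast hbd b hb k
      gcongr
    exact ((measure_mono hsub).trans_lt (by simp)).ne
  set c : ℕ → ℕ → ℝ := fun j d =>
    ∑ i ∈ Finset.range j, (a i : ℝ) * β⁻¹ ^ (i + 1) + d * β⁻¹ ^ (j + 1)
  -- The first drop splits a sequence into a beginning of `a`, a digit `d < a j` and a tail of the
  -- same kind. So `E` is covered by finitely many scaled copies of itself.
  have hcover : E ⊆ ⋃ j ∈ Finset.range m, ⋃ d ∈ Finset.range (a j),
      (c j d +ᵥ β⁻¹ ^ (j + 1) • E) := by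
    rintro _ ⟨b, hb, rfl⟩
    obtain ⟨j, hjm, h1, h2⟩ := hb 0
    simp only [zero_add] at h1 h2
    simp only [Set.mem_iUnion, Finset.mem_range]
    refine ⟨j, hjm, b j, h2, ?_⟩
    rw [Set.mem_vadd_set]
    refine ⟨β⁻¹ ^ (j + 1) • digitSum β (fun k => b (j + 1 + k)),
      Set.smul_mem_smul_set ⟨_, ?_, rfl⟩, ?_⟩
    · intro n
      obtain ⟨i, hi, h⟩ := hb (j + 1 + n)
      exact ⟨i, hi, by simpa only [add_assoc] using h⟩
    · rw [digitSum_split_succ (summable_digits ha.one_lt (hbd b hb)) j,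
        Finset.sum_congr rfl (fun i hi => by rw [h1 i (Finset.mem_range.1 hi)] :
        ∀ i ∈ Finset.range j, (b i : ℝ) * β⁻¹ ^ (i + 1) = (a i : ℝ) * β⁻¹ ^ (i + 1))]
      simp only [c, vadd_eq_add, smul_eq_mul]
      ring
  have hmeas : volume E ≤
      ∑ j ∈ Finset.range m, ∑ d ∈ Finset.range (a j), ENNReal.ofReal (β⁻¹ ^ (j + 1)) * volume E := by
    refine (measure_mono hcover).trans ((measure_biUnion_finset_le _ _).trans ?_)
    refine Finset.sum_le_sum fun j _ => (measure_biUnion_finset_le _ _).trans ?_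
    refine Finset.sum_le_sum fun d _ => ?_
    rw [measure_vadd, Measure.addHaar_smul, Module.finrank_self, pow_one,
      abs_of_pos (by positivity)]
  have hreal := ENNReal.toReal_mono (by
    refine (ENNReal.sum_lt_top.2 fun j _ => ENNReal.sum_lt_top.2 fun d _ => ?_).ne
    exact ENNReal.mul_lt_top ENNReal.ofReal_lt_top hfin.lt_top) hmeas
  rw [ENNReal.toReal_sum (fun j _ => (ENNReal.sum_lt_top.2 fun d _ =>
    ENNReal.mul_lt_top ENNReal.ofReal_lt_top hfin.lt_top).ne)] at hreal
  have hsimp : ∀ j, (∑ d ∈ Finset.range (a j),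
      ENNReal.ofReal (β⁻¹ ^ (j + 1)) * volume E).toReal =
      (a j : ℝ) * β⁻¹ ^ (j + 1) * (volume E).toReal := by
    intro j
    rw [Finset.sum_const, Finset.card_range, nsmul_eq_mul, ENNReal.toReal_mul, ENNReal.toReal_mul,
      ENNReal.toReal_ofReal (by positivity), ENNReal.toReal_natCast, mul_assoc]
  rw [Finset.sum_congr rfl fun j _ => hsimp j, ← Finset.sum_mul] at hreal
  -- The measure `V` satisfies `V ≤ qV`, where `q` is a partial sum of the expansion of 1. Since `q
  -- < 1` and `V` is finite, `V = 0`.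
  have hlt := ha.sum_lt_one m
  have h0 : 0 ≤ (volume E).toReal := ENNReal.toReal_nonneg
  have : (volume E).toReal = 0 := by nlinarith
  exact ((ENNReal.toReal_eq_zero_iff _).1 this).resolve_right hfin

/-- All tails of the two-sided sequence `e` are lexicographically at most `a`. -/
def Admissible (a : ℕ → ℕ) (e : ℤ → ℕ) : Prop :=
  ∀ (n : ℤ) (j : ℕ), (∀ i < j, e (n + i) = a i) → e (n + j) ≤ a j

theorem Admissible.tailsLE {e : ℤ → ℕ} (h : Admissible a e) (N : ℤ) :
    TailsLE a (fun k => e (N + k)) := by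
  intro n j hj
  have := h (N + n) j (fun i hi => by
    have := hj i hi
    push_cast at this
    rwa [← add_assoc] at this)
  push_cast
  rwa [← add_assoc]

theorem Admissible.le_zero {e : ℤ → ℕ} (h : Admissible a e) (n : ℤ) : e n ≤ a 0 := by
  simpa using h n 0 (by simp)

/-- The two-sided sequence that agrees with `b` from the position `-K` on and vanishes before. -/
def zeroExtend (K : ℕ) (b : ℕ → ℕ) (n : ℤ) : ℕ := if n < -K then 0 else b (n + K).toNat

theorem zeroExtend_of_lt {K : ℕ} {n : ℤ} (h : n < -K) : zeroExtend K b n = 0 := if_pos h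

theorem zeroExtend_add (K k : ℕ) : zeroExtend K b (-K + k) = b k := by
  rw [zeroExtend, if_neg (by omega)]
  congr 1
  omega

/-- A tail that starts among the added zeros is already below `a` in its first place, because `a 0 >
0`. -/
theorem TailsLE.zeroExtend (hb : TailsLE a b) (ha : 0 < a 0) (K : ℕ) :
    Admissible a (zeroExtend K b) := by
  intro n j hlt
  rcases lt_or_ge n (-K) with hn | hn
  · rcases Nat.eq_zero_or_pos j with rfl | hj
    · simp [zeroExtend_of_lt hn]
    · have := hlt 0 hj
      rw [Nat.cast_zero, add_zero, zeroExtend_of_lt hn] at this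
      omega
  · obtain ⟨m, hm⟩ := Int.eq_ofNat_of_zero_le (by omega : 0 ≤ n + K)
    have key : ∀ i : ℕ, ToralCoding.zeroExtend K b (n + i) = b (m + i) := fun i => by
      rw [← zeroExtend_add (b := b) K (m + i)]
      congr 1
      push_cast
      omega
    rw [key]
    exact hb m j fun i hi => by rw [← key]; exact hlt i hi

/-- The position `-K` has weight `β ^ K`, while a one-sided expansion gives its first digit the
weight `β⁻¹`; hence the factor `β ^ (K + 1)`. -/
theorem tendsto_sum_Icc (hβ : 0 < β) {e : ℤ → ℕ} {K : ℕ} (h0 : ∀ n < -(K : ℤ), e n = 0) {s : ℝ}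
    (hs : HasSum (fun k : ℕ => (e (-K + k) : ℝ) * β⁻¹ ^ (k + 1)) s) :
    Tendsto (fun p : ℕ × ℕ => ∑ n ∈ Finset.Icc (-(p.1 : ℤ)) (p.2 : ℤ), (e n : ℝ) * β ^ (-n))
      atTop (𝓝 (β ^ (K + 1) * s)) := by
  have h1 : Tendsto (fun p : ℕ × ℕ => β ^ (K + 1) *
      ∑ k ∈ Finset.range (p.2 + K + 1), (e (-K + k) : ℝ) * β⁻¹ ^ (k + 1)) atTop
      (𝓝 (β ^ (K + 1) * s)) := by
    refine (hs.tendsto_sum_nat.comp ?_).const_mul _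
    rw [← prod_atTop_atTop_eq]
    exact ((tendsto_add_atTop_nat (K + 1)).comp tendsto_snd)
  refine h1.congr' ?_
  filter_upwards [eventually_ge_atTop (K, 0)] with p hp
  have hpK : K ≤ p.1 := hp.1
  have h2 : ∑ n ∈ Finset.Icc (-(K : ℤ)) (p.2 : ℤ), (e n : ℝ) * β ^ (-n) =
      ∑ n ∈ Finset.Icc (-(p.1 : ℤ)) (p.2 : ℤ), (e n : ℝ) * β ^ (-n) := by
    refine Finset.sum_subset (Finset.Icc_subset_Icc (by omega) le_rfl) fun n hn hn' => ?_
    rw [Finset.mem_Icc] at hn hn'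
    rw [h0 n (by omega), Nat.cast_zero, zero_mul]
  rw [← h2, Finset.mul_sum]
  refine Finset.sum_nbij' (fun k => -(K : ℤ) + k) (fun n => (n + K).toNat) ?_ ?_ ?_ ?_ ?_
  · intro k hk
    rw [Finset.mem_range] at hk
    rw [Finset.mem_Icc]
    omega
  · intro n hn
    rw [Finset.mem_Icc] at hn
    rw [Finset.mem_range]
    omega
  · intro k _
    simp
  · intro n hn
    rw [Finset.mem_Icc] at hn
    omega
  · intro k _
    have : β ^ (-(-(K : ℤ) + k)) = β ^ (K + 1) * β⁻¹ ^ (k + 1) := by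
      rw [neg_add, neg_neg, zpow_add₀ hβ.ne', zpow_neg, zpow_natCast, zpow_natCast, inv_pow]
      field_simp
      ring
    rw [this]
    ring

end

/-! ### Eigenlines of the matrix and homoclinic points -/

section
variable {M : GL (Fin 2) ℤ}

/-- The matrix `M` with real entries. -/
noncomputable def realMat (M : GL (Fin 2) ℤ) : Matrix (Fin 2) (Fin 2) ℝ :=
  M.val.map (Int.cast : ℤ → ℝ)

theorem dt_eq_one_or (M : GL (Fin 2) ℤ) : dt M = 1 ∨ dt M = -1 :=
  Int.isUnit_iff.1 ((Matrix.isUnit_iff_isUnit_det _).1 M.isUnit)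

/-- Cayley–Hamilton, applied to a vector. -/
theorem realMat_mulVec_mulVec (M : GL (Fin 2) ℤ) (v : Fin 2 → ℝ) :
    (realMat M).mulVec ((realMat M).mulVec v) =
      (tr M : ℝ) • (realMat M).mulVec v - (dt M : ℝ) • v := by
  funext i
  fin_cases i <;>
  · simp [realMat, Matrix.mulVec, dotProduct, Fin.sum_univ_two, tr, dt, Matrix.trace_fin_two,
      Matrix.det_fin_two]
    ring

theorem realMat_inv_mulVec (M : GL (Fin 2) ℤ) (v : Fin 2 → ℝ) :
    (realMat M⁻¹).mulVec ((realMat M).mulVec v) = v := by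
  have h : realMat M⁻¹ * realMat M = 1 := by
    have h1 : (M⁻¹).val * M.val = 1 := by rw [← Units.val_mul, inv_mul_cancel, Units.val_one]
    have h2 := congrArg (fun B : Matrix (Fin 2) (Fin 2) ℤ => B.map (Int.castRingHom ℝ)) h1
    simp only [Matrix.map_mul] at h2
    simpa [realMat] using h2
  rw [Matrix.mulVec_mulVec, h, Matrix.one_mulVec]

theorem proj_add (v w : Fin 2 → ℝ) : proj (v + w) = proj v + proj w := rfl

theorem proj_sub (v w : Fin 2 → ℝ) : proj (v - w) = proj v - proj w := rfl

theorem proj_zero : proj 0 = 0 := rfl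

theorem proj_nsmul (n : ℕ) (v : Fin 2 → ℝ) : proj (n • v) = n • proj v := rfl

theorem continuous_proj : Continuous proj :=
  continuous_pi fun i => (AddCircle.continuous_mk' 1).comp (continuous_apply i)

theorem proj_eq_zero_iff {v : Fin 2 → ℝ} : proj v = 0 ↔ ∃ z : Fin 2 → ℤ, ∀ i, v i = z i := by
  constructor
  · intro h
    have : ∀ i, ∃ n : ℤ, (n : ℝ) = v i := fun i => by
      have := (AddCircle.coe_eq_zero_iff (1 : ℝ)).1 (congrFun h i)
      simpa using this
    choose z hz using this
    exact ⟨z, fun i => (hz i).symm⟩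
  · rintro ⟨z, hz⟩
    funext i
    exact (AddCircle.coe_eq_zero_iff (1 : ℝ)).2 ⟨z i, by simp [hz]⟩

theorem toralAut_inv_toralAut (x : Torus) : toralAut M⁻¹ (toralAut M x) = x := by
  rw [← toralAut_mul, inv_mul_cancel, toralAut_one]

theorem toralAut_zpow_succ (n : ℤ) (x : Torus) :
    toralAut (M ^ (n + 1)) x = toralAut M (toralAut (M ^ n) x) := by
  rw [← toralAut_mul, add_comm, zpow_add, zpow_one]

theorem toralAut_zpow_proj {μ : ℝ} (hμ : μ ≠ 0) {w : Fin 2 → ℝ}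
    (hw : (realMat M).mulVec w = μ • w) (n : ℤ) :
    toralAut (M ^ n) (proj w) = proj (μ ^ n • w) := by
  have hstep : ∀ c : ℝ, toralAut M (proj (c • w)) = proj ((μ * c) • w) := fun c => by
    rw [toralAut_proj]
    change proj ((realMat M).mulVec (c • w)) = _
    rw [Matrix.mulVec_smul, hw, smul_smul, mul_comm]
  induction n using Int.induction_on with
  | zero => simp [toralAut_one]
  | succ n ih => rw [toralAut_zpow_succ, ih, hstep, add_comm, zpow_add₀ hμ, zpow_one]
  | pred n ih =>
    have h1 : toralAut (M ^ (-(n : ℤ) - 1)) (proj w) =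
        toralAut M⁻¹ (toralAut (M ^ (-(n : ℤ))) (proj w)) := by
      rw [← toralAut_mul, sub_eq_neg_add, zpow_add, zpow_neg_one]
    rw [h1, ih]
    have h2 : μ ^ (-(n : ℤ)) = μ * μ ^ (-(n : ℤ) - 1) := by
      rw [zpow_sub_one₀ hμ]
      field_simp
    rw [h2, ← hstep, toralAut_inv_toralAut]

theorem exists_lift_norm_eq (x : UnitAddCircle) : ∃ y : ℝ, (y : UnitAddCircle) = x ∧ |y| = ‖x‖ := by
  obtain ⟨y, rfl⟩ := QuotientAddGroup.mk_surjective x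
  refine ⟨y - round y, ?_, (UnitAddCircle.norm_eq).symm⟩
  have h : ((round y : ℝ) : UnitAddCircle) = 0 :=
    (AddCircle.coe_eq_zero_iff (1 : ℝ)).2 ⟨round y, by simp⟩
  rw [AddCircle.coe_sub, h, sub_zero]

/-- A point of the torus whose forward orbit tends to zero lies on the projection of the
eigenline of the contracting eigenvalue `ν`. -/
theorem exists_eigenvector_of_tendsto {μ ν : ℝ} (hμ : 1 < |μ|) (hν : ν ≠ 0)
    (hch : ∀ v, (realMat M).mulVec ((realMat M).mulVec v) =
      (μ + ν) • (realMat M).mulVec v - (μ * ν) • v) {t : Torus}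
    (ht : Tendsto (fun n : ℕ => toralAut (M ^ n) t) atTop (𝓝 0)) :
    ∃ s, (realMat M).mulVec s = ν • s ∧ proj s = t := by
  choose l hl hnorm using exists_lift_norm_eq
  set v : ℕ → Fin 2 → ℝ := fun n i => l (toralAut (M ^ n) t i) with hv
  have hproj : ∀ n, proj (v n) = toralAut (M ^ n) t := fun n => funext fun i => hl _
  have hcont : Continuous fun x => (realMat M).mulVec x :=
    continuous_const.matrix_mulVec continuous_id
  have hv0 : Tendsto v atTop (𝓝 0) := by
    rw [tendsto_pi_nhds] at ht ⊢
    intro i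
    refine tendsto_zero_iff_norm_tendsto_zero.2 ?_
    have h1 := (tendsto_zero_iff_norm_tendsto_zero (E := UnitAddCircle)).1 (ht i)
    exact h1.congr fun n => (hnorm _).symm
  have hz0 : Tendsto (fun n => (realMat M).mulVec (v n) - v (n + 1)) atTop (𝓝 0) := by
    have h1 := (hcont.tendsto 0).comp hv0
    rw [Matrix.mulVec_zero] at h1
    simpa using h1.sub (hv0.comp (tendsto_add_atTop_nat 1))
  -- The defect of the lifts is an integer vector that tends to zero, so it eventually vanishes and
  -- the lifts form a genuine orbit of `M`.
  have hev : ∀ᶠ n in atTop, (realMat M).mulVec (v n) = v (n + 1) := by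
    filter_upwards [Metric.tendsto_nhds.1 hz0 1 one_pos] with n hn
    have h2 : proj ((realMat M).mulVec (v n) - v (n + 1)) = 0 := by
      rw [proj_sub, hproj, pow_succ', toralAut_mul, ← hproj n, toralAut_proj]
      exact sub_self _
    obtain ⟨z, hz⟩ := proj_eq_zero_iff.1 h2
    rw [dist_zero_right] at hn
    refine sub_eq_zero.1 (funext fun i => ?_)
    have h3 := (norm_le_pi_norm _ i).trans_lt hn
    rw [hz i, Real.norm_eq_abs, ← Int.cast_abs] at h3
    have h4 : |z i| < 1 := by exact_mod_cast h3
    rw [hz i, Int.abs_lt_one_iff.1 h4]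
    simp
  obtain ⟨N, hN⟩ := eventually_atTop.1 hev
  -- Applying `M - ν` removes the `ν`-component. What is left is multiplied by `μ` at each step and
  -- tends to zero, so it is zero.
  set u : ℕ → Fin 2 → ℝ := fun n => (realMat M).mulVec (v n) - ν • v n with hu
  have hu0 : Tendsto u atTop (𝓝 0) := by
    have h1 := (hcont.tendsto 0).comp hv0
    rw [Matrix.mulVec_zero] at h1
    have h2 := h1.sub (hv0.const_smul ν)
    rwa [smul_zero, sub_zero] at h2
  have hustep : ∀ k, u (N + k) = μ ^ k • u N := by
    intro k
    induction k with
    | zero => simp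
    | succ k ih =>
      have h1 : u (N + (k + 1)) = μ • u (N + k) := by
        have h2 := hN (N + k) (by omega)
        simp only [hu]
        rw [← add_assoc, ← h2, hch]
        module
      rw [h1, ih, smul_smul, pow_succ']
  have huN : u N = 0 := by
    have h1 : Tendsto (fun k => ‖u (N + k)‖) atTop (𝓝 0) := by
      have := hu0.norm
      rw [norm_zero] at this
      refine (this.comp (tendsto_add_atTop_nat N)).congr fun k => ?_
      rw [Function.comp_apply, add_comm]
    have h2 : ‖u N‖ ≤ 0 := by
      refine ge_of_tendsto' h1 fun k => ?_
      rw [hustep, norm_smul, norm_pow, Real.norm_eq_abs]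
      exact le_mul_of_one_le_left (norm_nonneg _) (one_le_pow₀ hμ.le)
    exact norm_le_zero_iff.1 h2
  have heig : (realMat M).mulVec (v N) = ν • v N := sub_eq_zero.1 huN
  refine ⟨ν ^ (-(N : ℤ)) • v N, ?_, ?_⟩
  · rw [Matrix.mulVec_smul, heig, smul_comm]
  · rw [← toralAut_zpow_proj hν heig, hproj, ← toralAut_mul, ← zpow_natCast, ← zpow_add,
      neg_add_cancel, zpow_zero, toralAut_one]

theorem mem_spectrum_of_root {z : ℂ} (hz : z ^ 2 - tr M * z + dt M = 0) :
    z ∈ spectrum ℂ (M.val.map (Int.cast : ℤ → ℂ)) := by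
  rw [Matrix.mem_spectrum_iff_isRoot_charpoly, Matrix.charpoly_fin_two, Polynomial.IsRoot.def]
  simp only [Polynomial.eval_add, Polynomial.eval_sub, Polynomial.eval_pow, Polynomial.eval_X,
    Polynomial.eval_mul, Polynomial.eval_C]
  rw [← hz]
  simp [tr, dt, Matrix.trace_fin_two, Matrix.det_fin_two]

/-- For determinant 1, trace 1 gives primitive sixth roots of unity and trace 2 gives the eigenvalue
1. -/
theorem IsHyperbolic.three_le_tr (hM : IsHyperbolic M) (hr : 0 < tr M) (hd : dt M = 1) :
    3 ≤ tr M := by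
  by_contra! hlt
  have h12 : tr M = 1 ∨ tr M = 2 := by omega
  rcases h12 with h | h
  · have h3 : (Complex.ofReal (√3)) ^ 2 = 3 := by
      rw [← Complex.ofReal_pow, Real.sq_sqrt (by norm_num)]; norm_num
    refine hM ((1 + √3 * Complex.I) / 2) (mem_spectrum_of_root ?_) ?_
    · rw [h, hd]
      push_cast
      linear_combination (1 / 4 : ℂ) * (√3 : ℂ) ^ 2 * Complex.I_sq - (1 / 4 : ℂ) * h3
    · have h4 : Complex.normSq ((1 + √3 * Complex.I) / 2) = 1 := by
        rw [Complex.normSq_div]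
        have : (1 + √3 * Complex.I : ℂ) = ((1 : ℝ) : ℂ) + (√3 : ℝ) * Complex.I := by simp
        rw [this, Complex.normSq_add_mul_I, Real.sq_sqrt (by norm_num)]
        norm_num
      have h5 := Complex.normSq_eq_norm_sq ((1 + √3 * Complex.I) / 2)
      rw [h4] at h5
      exact (pow_eq_one_iff_of_nonneg (norm_nonneg _) two_ne_zero).1 h5.symm
  · refine hM 1 (mem_spectrum_of_root ?_) (by simp)
    rw [h, hd]
    norm_num

/-- The discriminant of the characteristic polynomial is positive and not a square. -/
theorem IsHyperbolic.disc (hM : IsHyperbolic M) (hr : 0 < tr M) :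
    0 < tr M ^ 2 - 4 * dt M ∧ ¬ IsSquare (tr M ^ 2 - 4 * dt M) := by
  rcases dt_eq_one_or M with h | h
  · have h3 := hM.three_le_tr hr h
    rw [h]
    -- For `r ≥ 3` the number `r² - 4` lies strictly between `(r - 1)²` and `r²`.
    refine ⟨by nlinarith, ?_⟩
    rintro ⟨k, hk⟩
    have h1 : |k| < tr M := abs_lt_of_sq_lt_sq (by nlinarith) hr.le
    have h2 : tr M - 1 < |k| := lt_of_pow_lt_pow_left₀ 2 (abs_nonneg k) (by
      rw [sq_abs]; nlinarith)
    omega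
  · rw [h]
    -- The only square strictly between `r²` and `(r + 2)²` is `(r + 1)²`, and `r² + 4 = (r + 1)²`
    -- would give `2r = 3`.
    refine ⟨by nlinarith, ?_⟩
    rintro ⟨k, hk⟩
    have h1 : |k| * |k| = tr M ^ 2 + 4 := by rw [abs_mul_abs_self]; omega
    have h2 : tr M < |k| := by nlinarith [abs_nonneg k]
    have h3 : |k| < tr M + 2 := by nlinarith [abs_nonneg k]
    have h4 : |k| = tr M + 1 := by omega
    rw [h4] at h1
    have : 2 * tr M = 3 := by linarith
    omega

theorem IsHyperbolic.lam_sq (hM : IsHyperbolic M) (hr : 0 < tr M) :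
    lam M ^ 2 = tr M * lam M - dt M := by
  have h : (0 : ℝ) ≤ (tr M : ℝ) ^ 2 - 4 * (dt M : ℝ) := by exact_mod_cast (hM.disc hr).1.le
  have h1 := Real.sq_sqrt h
  rw [lam]
  linear_combination (1 / 4 : ℝ) * h1

theorem IsHyperbolic.one_lt_lam (hM : IsHyperbolic M) (hr : 0 < tr M) : 1 < lam M := by
  have h : (0 : ℝ) < (tr M : ℝ) ^ 2 - 4 * (dt M : ℝ) := by exact_mod_cast (hM.disc hr).1
  have h1 := Real.sqrt_pos.2 h
  have h2 : (1 : ℝ) ≤ tr M := by exact_mod_cast hr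
  rw [lam]
  rcases dt_eq_one_or M with hd | hd
  · have h3 : (3 : ℝ) ≤ tr M := by exact_mod_cast hM.three_le_tr hr hd
    linarith
  · have : (1 : ℝ) < √((tr M : ℝ) ^ 2 - 4 * (dt M : ℝ)) := by
      rw [Real.lt_sqrt one_pos.le, hd]
      push_cast
      nlinarith
    linarith

theorem IsHyperbolic.irrational_lam (hM : IsHyperbolic M) (hr : 0 < tr M) :
    Irrational (lam M) := by
  have h := hM.disc hr
  have h1 : Irrational (√((tr M ^ 2 - 4 * dt M : ℤ) : ℝ)) :=
    irrational_sqrt_intCast_iff.2 ⟨h.2, h.1.le⟩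
  have h2 := (h1.intCast_add (tr M)).div_natCast (m := 2) (by norm_num)
  rw [lam]
  push_cast at h2
  exact h2

/-- The contracting eigenvalue `σ / λ` of `M`. -/
noncomputable def lamConj (M : GL (Fin 2) ℤ) : ℝ := dt M * (lam M)⁻¹

theorem IsHyperbolic.lam_pos (hM : IsHyperbolic M) (hr : 0 < tr M) : 0 < lam M :=
  zero_lt_one.trans (hM.one_lt_lam hr)

theorem IsHyperbolic.lam_add_lamConj (hM : IsHyperbolic M) (hr : 0 < tr M) :
    lam M + lamConj M = tr M := by
  have h := hM.lam_sq hr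
  have h0 := hM.lam_pos hr
  rw [lamConj]
  field_simp
  linear_combination h

theorem IsHyperbolic.lam_mul_lamConj (hM : IsHyperbolic M) (hr : 0 < tr M) :
    lam M * lamConj M = dt M := by
  have h0 := hM.lam_pos hr
  rw [lamConj]
  field_simp

theorem abs_dt (M : GL (Fin 2) ℤ) : |(dt M : ℝ)| = 1 := by
  rcases dt_eq_one_or M with h | h <;> simp [h]

theorem IsHyperbolic.abs_lamConj (hM : IsHyperbolic M) (hr : 0 < tr M) :
    |lamConj M| = (lam M)⁻¹ := by
  rw [lamConj, abs_mul, abs_dt, one_mul, abs_of_pos (inv_pos.2 (hM.lam_pos hr))]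

theorem IsHyperbolic.lamConj_ne_zero (hM : IsHyperbolic M) (hr : 0 < tr M) : lamConj M ≠ 0 := by
  rw [← abs_pos, hM.abs_lamConj hr]
  exact inv_pos.2 (hM.lam_pos hr)

/-- A homoclinic point lies on the projections of both eigenlines. -/
theorem IsHomoclinic.exists_eigenvectors (hM : IsHyperbolic M) (hr : 0 < tr M) {t : Torus}
    (ht : IsHomoclinic M t) :
    (∃ w, (realMat M).mulVec w = lam M • w ∧ proj w = t) ∧
      ∃ s, (realMat M).mulVec s = lamConj M • s ∧ proj s = t := by
  have hpos := hM.lam_pos hr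
  have h1 := hM.one_lt_lam hr
  have hne := hM.lamConj_ne_zero hr
  have hadd := hM.lam_add_lamConj hr
  have hmul := hM.lam_mul_lamConj hr
  constructor
  -- The backward orbit is a forward orbit of `M⁻¹`, whose contracting eigenvalue is `λ⁻¹`; this is
  -- its Cayley–Hamilton identity.
  · have hch : ∀ v, (realMat M⁻¹).mulVec ((realMat M⁻¹).mulVec v) =
        ((lamConj M)⁻¹ + (lam M)⁻¹) • (realMat M⁻¹).mulVec v -
          ((lamConj M)⁻¹ * (lam M)⁻¹) • v := by
      intro v
      obtain ⟨u, rfl⟩ : ∃ u, (realMat M).mulVec u = v := by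
        refine ⟨(realMat M⁻¹).mulVec v, ?_⟩
        have := realMat_inv_mulVec M⁻¹ v
        rwa [inv_inv] at this
      obtain ⟨x, rfl⟩ : ∃ x, (realMat M).mulVec x = u := by
        refine ⟨(realMat M⁻¹).mulVec u, ?_⟩
        have := realMat_inv_mulVec M⁻¹ u
        rwa [inv_inv] at this
      rw [realMat_inv_mulVec, realMat_inv_mulVec, realMat_mulVec_mulVec, ← hadd, ← hmul]
      match_scalars <;> field_simp
      ring
    have htend : Tendsto (fun n : ℕ => toralAut (M⁻¹ ^ n) t) atTop (𝓝 0) := by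
      refine (ht.2.comp (tendsto_neg_atTop_atBot.comp tendsto_natCast_atTop_atTop)).congr
        fun n => ?_
      simp
    obtain ⟨w, hw, hwt⟩ := exists_eigenvector_of_tendsto (M := M⁻¹) (μ := (lamConj M)⁻¹)
      (ν := (lam M)⁻¹) (by rwa [abs_inv, hM.abs_lamConj hr, inv_inv]) (inv_ne_zero hpos.ne')
      hch htend
    refine ⟨w, ?_, hwt⟩
    have := realMat_inv_mulVec M⁻¹ w
    rw [inv_inv, hw, Matrix.mulVec_smul] at this
    rw [← this, smul_smul, mul_inv_cancel₀ hpos.ne', one_smul, this]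
  · refine exists_eigenvector_of_tendsto (μ := lam M) (ν := lamConj M)
      (by rwa [abs_of_pos hpos]) hne (fun v => ?_) ?_
    · rw [realMat_mulVec_mulVec, hadd, hmul]
    · refine (ht.1.comp tendsto_natCast_atTop_atTop).congr fun n => ?_
      simp

/-- An integer vector on the expanding eigenline is zero. -/
theorem eq_zero_of_mulVec_eq (hM : IsHyperbolic M) (hr : 0 < tr M) {v : Fin 2 → ℝ}
    (hv : (realMat M).mulVec v = lam M • v) (h0 : proj v = 0) : v = 0 := by
  obtain ⟨z, hz⟩ := proj_eq_zero_iff.1 h0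
  by_contra hne
  obtain ⟨i, hi⟩ := Function.ne_iff.1 hne
  have h1 := congrFun hv i
  simp only [Matrix.mulVec, dotProduct, Fin.sum_univ_two, realMat, Matrix.map_apply, hz,
    Pi.smul_apply, smul_eq_mul] at h1
  rw [hz, Pi.zero_apply] at hi
  have h2 := hM.irrational_lam hr
  -- A nonzero integer coordinate would exhibit `λ` as a quotient of integers.
  refine h2 ⟨((M.val i 0 * z 0 + M.val i 1 * z 1 : ℤ) : ℚ) / (z i : ℚ), ?_⟩
  push_cast
  rw [h1]
  field_simp

/-- An eigenvector of rational slope, or with vanishing first coordinate, would make its eigenvalue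
`λ` rational. -/
theorem exists_slope (hM : IsHyperbolic M) (hr : 0 < tr M) {w : Fin 2 → ℝ}
    (hw : (realMat M).mulVec w = lam M • w) (hne : w ≠ 0) :
    w 0 ≠ 0 ∧ ∃ α, Irrational α ∧ w 1 = α * w 0 := by
  have h0 := congrFun hw 0
  have h1 := congrFun hw 1
  simp only [Matrix.mulVec, dotProduct, Fin.sum_univ_two, realMat, Matrix.map_apply,
    Pi.smul_apply, smul_eq_mul] at h0 h1
  have hirr := hM.irrational_lam hr
  have hw0 : w 0 ≠ 0 := by
    intro hw0
    have hw1 : w 1 ≠ 0 := fun hw1 => hne (by funext i; fin_cases i <;> simp [hw0, hw1])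
    rw [hw0, mul_zero, zero_add] at h1
    exact hirr ⟨M.val 1 1, by exact_mod_cast mul_right_cancel₀ hw1 h1⟩
  refine ⟨hw0, w 1 / w 0, ?_, by field_simp⟩
  rintro ⟨q, hq⟩
  rw [eq_div_iff hw0] at hq
  refine hirr ⟨M.val 0 0 + M.val 0 1 * q, mul_right_cancel₀ hw0 ?_⟩
  rw [← h0, ← hq]
  push_cast
  ring

/-- A half-line of the expanding eigenline is dense in the torus. -/
theorem dense_proj_halfLine (hM : IsHyperbolic M) (hr : 0 < tr M) {w : Fin 2 → ℝ}
    (hw : (realMat M).mulVec w = lam M • w) (hne : w ≠ 0) :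
    Dense ((fun x : ℝ => proj (x • w)) '' Set.Ici 0) := by
  obtain ⟨hw0, α, hα, hw1⟩ := exists_slope hM hr hw hne
  intro y
  -- The parameters `(c + nκ) / w 0` keep the first coordinate equal to `y 0` modulo 1, while the
  -- second runs through `cα + nκα`, which is dense modulo 1. The sign `κ` and the integer shift `k`
  -- keep the parameters nonnegative.
  obtain ⟨κ, hκ, hκ0⟩ : ∃ κ : ℤ, κ ≠ 0 ∧ 0 < κ / w 0 := by
    rcases lt_or_gt_of_ne hw0 with h | h
    · exact ⟨-1, by norm_num, div_pos_of_neg_of_neg (by simp) h⟩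
    · exact ⟨1, by norm_num, div_pos (by simp) h⟩
  obtain ⟨c₀, hc₀⟩ := QuotientAddGroup.mk_surjective (y 0)
  obtain ⟨k, hk⟩ := exists_nat_gt (-(c₀ / w 0) / (κ / w 0))
  set c : ℝ := c₀ + k * κ with hc
  have hcpos : 0 ≤ c / w 0 := by
    rw [div_lt_iff₀ hκ0] at hk
    rw [hc, add_div, mul_div_assoc]
    linarith
  have hint : ∀ m : ℤ, ((m : ℝ) : UnitAddCircle) = 0 := fun m =>
    (AddCircle.coe_eq_zero_iff (1 : ℝ)).2 ⟨m, by simp⟩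
  have hdense : DenseRange (fun n : ℕ => n • (((κ * α : ℝ)) : UnitAddCircle)) := by
    rw [← denseRange_zsmul_iff_nsmul, AddCircle.denseRange_zsmul_coe_iff, div_one]
    exact hα.intCast_mul hκ
  set g : UnitAddCircle → Torus := fun z => ![y 0, ((c * α : ℝ) : UnitAddCircle) + z] with hg
  have hgc : Continuous g := by
    refine continuous_pi fun i => ?_
    fin_cases i
    · exact continuous_const
    · exact continuous_const_add ((c * α : ℝ) : UnitAddCircle)
  have hy : y = g (y 1 - ((c * α : ℝ) : UnitAddCircle)) := by
    funext i
    fin_cases i <;> simp [hg]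
  rw [hy]
  refine closure_mono ?_ (image_closure_subset_closure_image hgc
    (Set.mem_image_of_mem g (hdense (y 1 - ((c * α : ℝ) : UnitAddCircle)))))
  rintro _ ⟨_, ⟨n, rfl⟩, rfl⟩
  refine ⟨c / w 0 + n * (κ / w 0), Set.mem_Ici.2 (by positivity), ?_⟩
  have hy0 : y 0 = ((c₀ : ℝ) : UnitAddCircle) := hc₀.symm
  funext i
  fin_cases i
  · have : (c / w 0 + n * (κ / w 0)) * w 0 = c₀ + (((k + n) * κ : ℤ) : ℝ) := by
      rw [hc]; push_cast; field_simp; ring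
    simp only [hg, proj, Pi.smul_apply, smul_eq_mul, Fin.zero_eta, Matrix.cons_val_zero]
    rw [this, AddCircle.coe_add, hint, add_zero, hy0]
  · have : (c / w 0 + n * (κ / w 0)) * (α * w 0) = c * α + n • (κ * α) := by
      rw [nsmul_eq_mul]; field_simp
    simp only [hg, proj, Pi.smul_apply, smul_eq_mul, Fin.mk_one, Matrix.cons_val_one, hw1]
    rw [this, AddCircle.coe_add, AddCircle.coe_nsmul]
    simp

end

/-! ### Topology of the primary space and the two half-sums -/

section
variable {M : GL (Fin 2) ℤ}

theorem mem_primarySubmonoid_of_finite {f : ℤ → ℕ} (hf : (Function.support f).Finite) :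
    f ∈ primarySubmonoid M := by
  constructor
  · refine summable_of_hasFiniteSupport ((hf.preimage (f := fun n : ℕ => (n : ℤ) + 1)
      (fun a _ b _ h => by simpa using h)).subset fun n hn => ?_)
    exact fun h0 => hn (by simp [h0])
  · refine summable_of_hasFiniteSupport ((hf.preimage (f := fun n : ℕ => -((n : ℤ) + 1))
      (fun a _ b _ h => by simpa using h)).subset fun n hn => ?_)
    exact fun h0 => hn (by simp only; rw [h0]; simp)

theorem mem_primarySubmonoid_of_le (hl : 1 < lam M) {f : ℤ → ℕ} {C : ℕ} (hf : ∀ n, f n ≤ C) :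
    f ∈ primarySubmonoid M :=
  ⟨summable_digits hl fun _ => hf _, summable_digits hl fun _ => hf _⟩

theorem PrimarySpace.ext {e e' : PrimarySpace M} (h : e.seq = e'.seq) : e = e' := Subtype.ext h

theorem PrimarySpace.summable_pos (e : PrimarySpace M) :
    Summable fun n : ℕ => (e.seq (n + 1) : ℝ) * (lam M)⁻¹ ^ (n + 1) := (Subtype.property e).1

theorem PrimarySpace.summable_neg (e : PrimarySpace M) :
    Summable fun n : ℕ => (e.seq (-(n + 1)) : ℝ) * (lam M)⁻¹ ^ (n + 1) := (Subtype.property e).2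

theorem PrimarySpace.seq_zero : (0 : PrimarySpace M).seq = 0 := rfl

/-- The underlying sequence as a homomorphism. -/
def seqHom (M : GL (Fin 2) ℤ) : PrimarySpace M →+ (ℤ → ℕ) where
  toFun := PrimarySpace.seq
  map_zero' := rfl
  map_add' _ _ := rfl

theorem isInducing_primarySpace : IsInducing
    (fun e : PrimarySpace M => ((e.seq, e.sumPos, e.sumNeg) : (ℤ → ℕ) × ℝ × ℝ)) := ⟨rfl⟩

theorem continuous_seq : Continuous (PrimarySpace.seq : PrimarySpace M → ℤ → ℕ) :=
  continuous_fst.comp isInducing_primarySpace.continuous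

theorem continuous_seq_apply (n : ℤ) : Continuous fun e : PrimarySpace M => e.seq n :=
  (continuous_apply n).comp continuous_seq

theorem continuous_sumPos : Continuous (PrimarySpace.sumPos : PrimarySpace M → ℝ) :=
  (continuous_fst.comp continuous_snd).comp isInducing_primarySpace.continuous

theorem continuous_sumNeg : Continuous (PrimarySpace.sumNeg : PrimarySpace M → ℝ) :=
  (continuous_snd.comp continuous_snd).comp isInducing_primarySpace.continuous

theorem tendsto_primarySpace {ι : Type*} {l : Filter ι} {u : ι → PrimarySpace M}
    {e : PrimarySpace M} (h : ∀ n, ∀ᶠ i in l, (u i).seq n = e.seq n)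
    (hpos : Tendsto (fun i => (u i).sumPos) l (𝓝 e.sumPos))
    (hneg : Tendsto (fun i => (u i).sumNeg) l (𝓝 e.sumNeg)) : Tendsto u l (𝓝 e) := by
  rw [isInducing_primarySpace.tendsto_nhds_iff]
  refine Tendsto.prodMk_nhds (tendsto_pi_nhds.2 fun n => ?_) (hpos.prodMk_nhds hneg)
  exact tendsto_const_nhds.congr' ((h n).mono fun i hi => hi.symm)

/-- The sequence with the digit `1` at the position `n` and zeros elsewhere. -/
noncomputable def single (M : GL (Fin 2) ℤ) (n : ℤ) : PrimarySpace M :=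
  ⟨Pi.single n 1, mem_primarySubmonoid_of_finite
    ((Set.finite_singleton n).subset Pi.support_single_subset)⟩

theorem single_seq (n m : ℤ) : (single M n).seq m = if m = n then 1 else 0 := Pi.single_apply n 1 m

theorem shift_single (n : ℤ) : shift (single M (n + 1)) = single M n := by
  refine PrimarySpace.ext (funext fun m => ?_)
  simp [shift_seq, single_seq]

theorem tendsto_single_natCast (hl : 1 < lam M) :
    Tendsto (fun k : ℕ => single M (k + 1)) atTop (𝓝 0) := by
  refine tendsto_primarySpace (fun n => ?_) ?_ ?_
  · filter_upwards [eventually_gt_atTop n.toNat] with k hk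
    rw [single_seq, if_neg (by omega)]
    rfl
  · have h : ∀ k : ℕ, (single M (k + 1)).sumPos = (lam M)⁻¹ ^ (k + 1) := fun k => by
      rw [PrimarySpace.sumPos, tsum_eq_single k]
      · simp [single_seq]
      · intro b hb
        simp [single_seq, hb]
    simp only [h]
    have h0 : (0 : PrimarySpace M).sumPos = 0 := by simp [PrimarySpace.sumPos, PrimarySpace.seq_zero]
    rw [h0]
    exact (tendsto_pow_atTop_nhds_zero_of_lt_one (inv_nonneg.2 (zero_lt_one.trans hl).le)
      (inv_lt_one_of_one_lt₀ hl)).comp (tendsto_add_atTop_nat 1)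
  · have h : ∀ k : ℕ, (single M (k + 1)).sumNeg = (0 : PrimarySpace M).sumNeg := fun k => by
      rw [PrimarySpace.sumNeg, PrimarySpace.sumNeg]
      congr 1
    simp only [h]
    exact tendsto_const_nhds

theorem tendsto_single_neg_natCast (hl : 1 < lam M) :
    Tendsto (fun k : ℕ => single M (-(k + 1))) atTop (𝓝 0) := by
  refine tendsto_primarySpace (fun n => ?_) ?_ ?_
  · filter_upwards [eventually_gt_atTop (-n).toNat] with k hk
    rw [single_seq, if_neg (by omega)]
    rfl
  · have h : ∀ k : ℕ, (single M (-(k + 1))).sumPos = (0 : PrimarySpace M).sumPos := fun k => by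
      rw [PrimarySpace.sumPos, PrimarySpace.sumPos]
      congr 1
    simp only [h]
    exact tendsto_const_nhds
  · have h : ∀ k : ℕ, (single M (-(k + 1))).sumNeg = (lam M)⁻¹ ^ (k + 1) := fun k => by
      rw [PrimarySpace.sumNeg, tsum_eq_single k]
      · simp [single_seq]
      · intro b hb
        rw [single_seq, if_neg (by omega)]
        simp
    simp only [h]
    have h0 : (0 : PrimarySpace M).sumNeg = 0 := by simp [PrimarySpace.sumNeg, PrimarySpace.seq_zero]
    rw [h0]
    exact (tendsto_pow_atTop_nhds_zero_of_lt_one (inv_nonneg.2 (zero_lt_one.trans hl).le)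
      (inv_lt_one_of_one_lt₀ hl)).comp (tendsto_add_atTop_nat 1)

theorem tendsto_single_atTop (hl : 1 < lam M) : Tendsto (single M) atTop (𝓝 0) := by
  rw [← Nat.map_cast_int_atTop, tendsto_map'_iff, ← tendsto_add_atTop_iff_nat 1]
  exact (tendsto_single_natCast hl).congr fun k => by simp

theorem tendsto_single_atBot (hl : 1 < lam M) : Tendsto (single M) atBot (𝓝 0) := by
  have h : Tendsto (fun n : ℤ => single M (-n)) atTop (𝓝 0) := by
    rw [← Nat.map_cast_int_atTop, tendsto_map'_iff, ← tendsto_add_atTop_iff_nat 1]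
    exact (tendsto_single_neg_natCast hl).congr fun k => by simp
  exact (h.comp tendsto_neg_atBot_atTop).congr fun n => by simp

/-- The restriction of a sequence to the positions `-k, …, k`. -/
noncomputable def trunc (e : PrimarySpace M) (k : ℕ) : PrimarySpace M :=
  ∑ n ∈ Finset.Icc (-(k : ℤ)) k, e.seq n • single M n

theorem trunc_seq (e : PrimarySpace M) (k : ℕ) (m : ℤ) :
    (trunc e k).seq m = if m ∈ Finset.Icc (-(k : ℤ)) k then e.seq m else 0 := by
  change seqHom M (trunc e k) m = _
  rw [trunc, map_sum, Finset.sum_apply]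
  have h : ∀ n, seqHom M (e.seq n • single M n) m = if m = n then e.seq n else 0 := fun n => by
    rw [map_nsmul, Pi.smul_apply]
    change e.seq n • (single M n).seq m = _
    rw [single_seq]
    simp
  simp only [h, Finset.sum_ite_eq]

/-- The two sums of a truncation are partial sums of those of `e`, so finite sequences are dense. -/
theorem tendsto_trunc (e : PrimarySpace M) : Tendsto (trunc e) atTop (𝓝 e) := by
  refine tendsto_primarySpace (fun n => ?_) ?_ ?_
  · filter_upwards [eventually_ge_atTop n.natAbs] with k hk
    rw [trunc_seq, if_pos (Finset.mem_Icc.2 (by omega))]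
  · refine e.summable_pos.hasSum.tendsto_sum_nat.congr fun k => ?_
    rw [PrimarySpace.sumPos, tsum_eq_sum (s := Finset.range k)]
    · refine Finset.sum_congr rfl fun n hn => ?_
      rw [Finset.mem_range] at hn
      rw [trunc_seq, if_pos (Finset.mem_Icc.2 (by omega))]
    · intro n hn
      rw [Finset.mem_range] at hn
      rw [trunc_seq, if_neg (by rw [Finset.mem_Icc]; omega)]
      simp
  · refine e.summable_neg.hasSum.tendsto_sum_nat.congr fun k => ?_
    rw [PrimarySpace.sumNeg, tsum_eq_sum (s := Finset.range k)]
    · refine Finset.sum_congr rfl fun n hn => ?_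
      rw [Finset.mem_range] at hn
      rw [trunc_seq, if_pos (Finset.mem_Icc.2 (by omega))]
    · intro n hn
      rw [Finset.mem_range] at hn
      rw [trunc_seq, if_neg (by rw [Finset.mem_Icc]; omega)]
      simp

/-- The tails of the dominating series are continuous in `x`, so a tail that is small at one point
is small nearby. Digits are unbounded on the primary space, so no constant majorant is available. -/
theorem continuous_tsum_of_le {X : Type*} [TopologicalSpace X] {f g : ℕ → X → ℝ}
    (hf : ∀ n, Continuous (f n)) (hg : ∀ n, Continuous (g n)) (hfg : ∀ n x, |f n x| ≤ g n x)
    (hs : ∀ x, Summable fun n => g n x) (hc : Continuous fun x => ∑' n, g n x) :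
    Continuous fun x => ∑' n, f n x := by
  refine continuous_of_locally_uniform_approx_of_continuousAt fun x u hu => ?_
  obtain ⟨δ, hδ, hu⟩ := Metric.mem_uniformity_dist.1 hu
  have hR : ∀ N, Continuous fun y => ∑' n, g n y - ∑ n ∈ Finset.range N, g n y := fun N =>
    hc.sub (continuous_finsetSum _ fun n _ => hg n)
  have hlim : Tendsto (fun N => ∑' n, g n x - ∑ n ∈ Finset.range N, g n x) atTop (𝓝 0) := by
    simpa using (hs x).hasSum.tendsto_sum_nat.const_sub (∑' n, g n x)
  obtain ⟨N, hN⟩ := (hlim.eventually (gt_mem_nhds hδ)).exists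
  refine ⟨{y | ∑' n, g n y - ∑ n ∈ Finset.range N, g n y < δ},
    (hR N).continuousAt.eventually (gt_mem_nhds hN),
    fun y => ∑ n ∈ Finset.range N, f n y,
    (continuous_finsetSum _ fun n _ => hf n).continuousAt, fun y hy => hu ?_⟩
  have hsf : Summable fun n => f n y := Summable.of_norm_bounded (hs y) fun n => hfg n y
  rw [Real.dist_eq]
  rw [Set.mem_ofPred_eq, ← (hs y).sum_add_tsum_nat_add N, add_sub_cancel_left] at hy
  rw [← hsf.sum_add_tsum_nat_add N, add_sub_cancel_left]
  refine lt_of_le_of_lt ?_ hy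
  rw [← Real.norm_eq_abs]
  exact tsum_of_norm_bounded ((summable_nat_add_iff N).2 (hs y)).hasSum fun n => hfg (n + N) y

/-- The sum `∑_{n ≥ 1} ε_{-n} (σ / λ)^n`. -/
noncomputable def contractSum (e : PrimarySpace M) : ℝ :=
  ∑' n : ℕ, (e.seq (-(n + 1)) : ℝ) * lamConj M ^ (n + 1)

/-- The sum `∑_{n ≥ 0} ε_n λ^{-n}`. -/
noncomputable def expandSum (e : PrimarySpace M) : ℝ := e.seq 0 + e.sumPos

theorem continuous_expandSum : Continuous (expandSum : PrimarySpace M → ℝ) :=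
  (continuous_of_discreteTopology.comp (continuous_seq_apply 0)).add continuous_sumPos

theorem abs_contract_le (h : |lamConj M| = (lam M)⁻¹) (e : PrimarySpace M) (n : ℕ) :
    |(e.seq (-(n + 1)) : ℝ) * lamConj M ^ (n + 1)| ≤
      (e.seq (-(n + 1)) : ℝ) * (lam M)⁻¹ ^ (n + 1) := by
  rw [abs_mul, abs_pow, h, Nat.abs_cast]

theorem summable_contract (h : |lamConj M| = (lam M)⁻¹) (e : PrimarySpace M) :
    Summable fun n : ℕ => (e.seq (-(n + 1)) : ℝ) * lamConj M ^ (n + 1) :=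
  Summable.of_norm_bounded e.summable_neg (abs_contract_le h e)

theorem continuous_contractSum (h : |lamConj M| = (lam M)⁻¹) :
    Continuous (contractSum : PrimarySpace M → ℝ) := by
  have hd : ∀ n : ℤ, Continuous fun e : PrimarySpace M => (e.seq n : ℝ) := fun n =>
    continuous_of_discreteTopology.comp (continuous_seq_apply n)
  exact continuous_tsum_of_le (fun n => (hd _).mul_const _) (fun n => (hd _).mul_const _)
    (fun n e => abs_contract_le h e n) PrimarySpace.summable_neg continuous_sumNeg

theorem expandSum_add (e e' : PrimarySpace M) :
    expandSum (e + e') = expandSum e + expandSum e' := by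
  have : (e + e').sumPos = e.sumPos + e'.sumPos := by
    rw [PrimarySpace.sumPos, PrimarySpace.sumPos, PrimarySpace.sumPos,
      ← e.summable_pos.tsum_add e'.summable_pos]
    congr 1
    ext n
    simp [PrimarySpace.seq_add, add_mul]
  rw [expandSum, expandSum, expandSum, this, PrimarySpace.seq_add, Pi.add_apply, Nat.cast_add]
  ring

theorem contractSum_add (h : |lamConj M| = (lam M)⁻¹) (e e' : PrimarySpace M) :
    contractSum (e + e') = contractSum e + contractSum e' := by
  rw [contractSum, contractSum, contractSum,
    ← (summable_contract h e).tsum_add (summable_contract h e')]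
  congr 1
  ext n
  simp [PrimarySpace.seq_add, add_mul]

/-- The shift moves the digit at position 0 from the expanding half to the contracting half: it is
subtracted here and added in `contractSum_shift`. -/
theorem expandSum_shift (h : lam M ≠ 0) (e : PrimarySpace M) :
    expandSum (shift e) = lam M * (expandSum e - e.seq 0) := by
  have h1 : e.sumPos = ∑' n : ℕ, (e.seq (n + 1) : ℝ) * (lam M)⁻¹ ^ (n + 1) := rfl
  rw [expandSum, expandSum, add_sub_cancel_left, h1, ← e.summable_pos.sum_add_tsum_nat_add 1,
    mul_add, ← tsum_mul_left, PrimarySpace.sumPos]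
  congr 1
  · simp only [shift_seq, Finset.sum_range_one, Nat.cast_zero, zero_add, pow_one]
    field_simp
  · congr 1
    ext n
    rw [shift_seq]
    push_cast
    rw [pow_succ _ (n + 1)]
    field_simp

theorem contractSum_shift (h : |lamConj M| = (lam M)⁻¹) (e : PrimarySpace M) :
    contractSum (shift e) = lamConj M * (e.seq 0 + contractSum e) := by
  rw [contractSum, ← (summable_contract h (shift e)).sum_add_tsum_nat_add 1, mul_add, contractSum,
    ← tsum_mul_left]
  congr 1
  · simp [shift_seq, mul_comm]
  · congr 1
    ext n
    rw [shift_seq, show (-(((n + 1 : ℕ) : ℤ) + 1) + 1 : ℤ) = -((n : ℤ) + 1) by push_cast; ring]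
    ring

/-- With bounded digits both sums converge uniformly, so the compact product topology maps
continuously to the weak one. -/
theorem isCompact_of_isClosed_of_le (hl : 1 < lam M) {C : Set (ℤ → ℕ)} (hC : IsClosed C) {R : ℕ}
    (hR : ∀ f ∈ C, ∀ n, f n ≤ R) : IsCompact {e : PrimarySpace M | e.seq ∈ C} := by
  have hK : IsCompact C := by
    refine (isCompact_univ_pi (s := fun _ : ℤ => Set.Iic R) fun _ =>
      (Set.finite_Iic R).isCompact).of_isClosed_subset hC fun f hf n _ => hR f hf n
  have := isCompact_iff_compactSpace.1 hK
  set g : C → PrimarySpace M := fun f =>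
    ⟨f.1, mem_primarySubmonoid_of_le hl (hR f.1 f.2)⟩ with hg
  have hd : ∀ n : ℤ, Continuous fun f : C => (f.1 n : ℝ) := fun n =>
    continuous_of_discreteTopology.comp ((continuous_apply n).comp continuous_subtype_val)
  have hb : Summable fun n : ℕ => (R : ℝ) * (lam M)⁻¹ ^ (n + 1) :=
    summable_digits hl (b := fun _ => R) fun _ => le_rfl
  have hle : ∀ (n : ℕ) (m : ℤ) (f : C), ‖(f.1 m : ℝ) * (lam M)⁻¹ ^ (n + 1)‖ ≤
      (R : ℝ) * (lam M)⁻¹ ^ (n + 1) := fun n m f => by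
    have h0 : 0 < lam M := zero_lt_one.trans hl
    have h1 : (f.1 m : ℝ) ≤ R := by exact_mod_cast hR f.1 f.2 m
    rw [Real.norm_of_nonneg (by positivity)]
    gcongr
  have hgc : Continuous g := by
    rw [isInducing_primarySpace.continuous_iff]
    refine continuous_subtype_val.prodMk (Continuous.prodMk ?_ ?_)
    · exact continuous_tsum (fun n => (hd _).mul_const _) hb fun n f => hle n _ f
    · exact continuous_tsum (fun n => (hd _).mul_const _) hb fun n f => hle n _ f
  convert isCompact_range hgc
  ext e
  constructor
  · intro he
    exact ⟨⟨e.seq, he⟩, rfl⟩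
  · rintro ⟨f, rfl⟩
    exact f.2

theorem isClosed_admissible (a : ℕ → ℕ) : IsClosed {e | Admissible a e} := by
  simp only [Admissible, Set.ofPred_forall]
  refine isClosed_iInter fun n => isClosed_iInter fun j => ?_
  have hc : ∀ m : ℤ, Continuous fun e : ℤ → ℕ => e m := fun m => continuous_apply m
  have ho : IsOpen {e : ℤ → ℕ | ∀ i < j, e (n + i) = a i} := by
    have : {e : ℤ → ℕ | ∀ i < j, e (n + i) = a i} =
        ⋂ i ∈ Set.Iio j, (fun e : ℤ → ℕ => e (n + i)) ⁻¹' {a i} := by ext; simp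
    rw [this]
    exact (Set.finite_Iio j).isOpen_biInter fun i _ => (isOpen_discrete _).preimage (hc _)
  have hcl : IsClosed {e : ℤ → ℕ | e (n + j) ≤ a j} := isClosed_le (hc _) continuous_const
  simpa only [← Set.ofPred_forall] using isClosed_imp ho hcl

end

/-! ### The critical sequence, the compacta and totality -/

section
variable {M : GL (Fin 2) ℤ}

theorem lexLE_iff {a b : ℕ → ℕ} : LexLE a b ↔ ∀ j, (∀ i < j, a i = b i) → a j ≤ b j := by
  constructor
  · rintro (rfl | ⟨n, h1, h2⟩) j hj
    · rfl
    · rcases lt_trichotomy j n with h | rfl | h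
      · exact (h1 j h).le
      · exact h2.le
      · exact absurd (hj n h) h2.ne
  · intro h
    by_cases hab : a = b
    · exact Or.inl hab
    · obtain ⟨J, hJ⟩ := Function.ne_iff.1 hab
      obtain ⟨j, -, h1, h2⟩ := exists_first_lt h hJ
      exact Or.inr ⟨j, h1, h2⟩

theorem LexLE.trans {a b c : ℕ → ℕ} (hab : LexLE a b) (hbc : LexLE b c) : LexLE a c := by
  rcases hab with rfl | ⟨n, h1, h2⟩
  · exact hbc
  rcases hbc with rfl | ⟨m, h3, h4⟩
  · exact Or.inr ⟨n, h1, h2⟩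
  refine Or.inr ⟨min n m, fun i hi => ?_, ?_⟩
  · rw [h1 i (by omega), h3 i (by omega)]
  · rcases lt_trichotomy n m with h | rfl | h
    · rw [min_eq_left h.le, ← h3 n h]
      exact h2
    · rw [min_self]
      exact h2.trans h4
    · rw [min_eq_right h.le, h1 m h]
      exact h4

theorem admissible_iff_lexLE {a : ℕ → ℕ} {e : ℤ → ℕ} :
    Admissible a e ↔ ∀ n, LexLE (tail e n) a :=
  forall_congr' fun _ => lexLE_iff.symm

theorem isTotal_admissible (a : ℕ → ℕ) :
    IsTotal {e : PrimarySpace M | Admissible a e.seq} := by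
  intro e he e' h
  obtain ⟨N, hN⟩ := h
  refine admissible_iff_lexLE.2 fun n => ?_
  have h1 := hN (n - N)
  rw [add_sub_cancel] at h1
  exact h1.trans (admissible_iff_lexLE.1 he N)

/-- The quasi-greedy expansion of `1` in base `λ`: `r, 0, r, 0, …` if `det M = -1` and
`r - 1, r - 2, r - 2, …` otherwise. -/
def critSeq (M : GL (Fin 2) ℤ) : ℕ → ℕ :=
  if dt M = -1 then fun j => if Even j then (tr M).toNat else 0
  else fun j => if j = 0 then (tr M).toNat - 1 else (tr M).toNat - 2

theorem isCritical_critSeq (hM : IsHyperbolic M) (hr : 0 < tr M) :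
    IsCritical (lam M) (critSeq M) := by
  have hsq := hM.lam_sq hr
  have hl := hM.one_lt_lam hr
  have hcast : ((tr M).toNat : ℝ) = tr M := by exact_mod_cast Int.toNat_of_nonneg hr.le
  rcases dt_eq_one_or M with h | h
  · have h3 := hM.three_le_tr hr h
    rw [critSeq, if_neg (by omega)]
    refine isCritical_sofic hl (by omega) ?_
    rw [hsq, hcast, h]
    simp
  · rw [critSeq, if_pos h]
    refine isCritical_markov hl (by omega) ?_
    rw [hsq, hcast, h]
    simp

theorem admissible_iff_mem_markovCompactum {r : ℕ} {e : ℤ → ℕ} :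
    Admissible (fun j => if Even j then r else 0) e ↔ e ∈ markovCompactum r := by
  simp only [Admissible]
  constructor
  · intro h n
    refine ⟨by simpa using h n 0 (by simp), fun hn => ?_⟩
    have := h n 1 (fun i hi => by
      obtain rfl : i = 0 := by omega
      simpa using hn)
    simpa using this
  · intro h n j hj
    by_cases hev : Even j
    · simpa [hev] using (h (n + j)).1
    · obtain ⟨i, rfl⟩ : ∃ i, j = i + 1 := ⟨j - 1, by
        rcases Nat.eq_zero_or_pos j with rfl | h0
        · simp at hev
        · omega⟩
      have hi : Even i := by
        rw [Nat.even_add_one, not_not] at hev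
        exact hev
      have h1 := hj i (by omega)
      rw [if_pos hi] at h1
      -- At an odd place the matched beginning ends in `r`, which forces the next digit to be 0.
      have h2 := (h (n + i)).2 (by exact_mod_cast h1)
      rw [Nat.cast_add, Nat.cast_one, ← add_assoc, h2]
      exact Nat.zero_le _

theorem admissible_iff_mem_soficCompactum {r : ℕ} (hr : 3 ≤ r) {e : ℤ → ℕ} :
    Admissible (fun j => if j = 0 then r - 1 else r - 2) e ↔ e ∈ soficCompactum r := by
  simp only [Admissible]
  constructor
  · intro h n
    have h0 : e n ≤ r - 1 := by simpa using h n 0 (by simp)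
    refine ⟨by omega, fun s => ?_⟩
    rintro ⟨h1, h2, h3⟩
    have h4 := h n (s + 1) (fun i hi => by
      rcases Nat.eq_zero_or_pos i with rfl | hpos
      · simp only [Nat.cast_zero, add_zero, if_true]
        omega
      · have := h2 i hpos (by omega)
        rw [if_neg hpos.ne']
        omega)
    rw [if_neg (by omega), Nat.cast_add, Nat.cast_one, ← add_assoc] at h4
    omega
  · intro h n j hj
    have h0 := (h (n + j)).1
    rcases Nat.eq_zero_or_pos j with rfl | hpos
    · simp only [if_true]
      omega
    · rw [if_neg hpos.ne']
      by_contra! hlt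
      -- A first excess over `a` at the place `j ≥ 1` completes the forbidden block with `s = j -
      -- 1`.
      refine (h n).2 (j - 1) ⟨?_, fun i h1 h2 => ?_, ?_⟩
      · have := hj 0 hpos
        simp only [Nat.cast_zero, add_zero, if_true] at this
        omega
      · have := hj i (by omega)
        rw [if_neg (by omega)] at this
        omega
      · have : n + ((j - 1 : ℕ) : ℤ) + 1 = n + j := by omega
        rw [this]
        omega

theorem mem_compactum_iff (hM : IsHyperbolic M) (hr : 0 < tr M) {e : ℤ → ℕ} :
    e ∈ compactum M ↔ Admissible (critSeq M) e := by
  have hcast : ((tr M).toNat : ℤ) = tr M := Int.toNat_of_nonneg hr.le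
  rcases dt_eq_one_or M with h | h
  · have h3 := hM.three_le_tr hr h
    rw [compactum, critSeq, if_neg (by omega), if_neg (by omega),
      admissible_iff_mem_soficCompactum (by omega), hcast]
  · rw [compactum, critSeq, if_pos h, if_pos h, admissible_iff_mem_markovCompactum, hcast]

theorem Admissible.trunc {a : ℕ → ℕ} (h0 : 0 < a 0) {e : PrimarySpace M}
    (he : Admissible a e.seq) (k : ℕ) : Admissible a (trunc e k).seq := by
  intro n j hj
  rw [trunc_seq]
  split_ifs with hm
  · rw [Finset.mem_Icc] at hm
    rcases lt_or_ge n (-k) with hn | hn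
    · have := hj 0 (by omega)
      rw [trunc_seq, if_neg (by rw [Finset.mem_Icc]; omega)] at this
      omega
    · refine he n j fun i hi => ?_
      rw [← hj i hi, trunc_seq, if_pos (by rw [Finset.mem_Icc]; omega)]
  · exact Nat.zero_le _

/-- A closed total set whose tails match arbitrarily long beginnings of `a` contains all
admissible sequences. -/
theorem admissible_subset_of_matching {a : ℕ → ℕ} {β : ℝ} (ha : IsCritical β a)
    {X : Set (PrimarySpace M)} (hX : IsClosed X) (htot : IsTotal X)
    (hmatch : ∀ m, ∃ e ∈ X, ∃ n : ℤ, ∀ i : ℕ, i < m → e.seq (n + i) = a i) :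
    {e : PrimarySpace M | Admissible a e.seq} ⊆ X := by
  intro e he
  refine hX.mem_of_tendsto (tendsto_trunc e) (Eventually.of_forall fun k => ?_)
  -- A tail starting in the window has left it after `2k + 1` places, so it has the digit 0 at a
  -- place `J` where `a` is positive. Hence it drops below `a` at or before `J`, and agreement of
  -- `e₀` with `a` through `J` suffices.
  obtain ⟨J, hJ, haJ⟩ := ha.frequently_pos (2 * k + 1)
  obtain ⟨e₀, he₀, n₀, hmatch⟩ := hmatch (J + 1)
  have hadm := Admissible.trunc ha.zero_pos he k
  refine htot e₀ he₀ _ ⟨n₀, fun l => Or.inr ?_⟩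
  obtain ⟨j, hj, h1, h2⟩ : ∃ j ≤ J, (∀ i < j, tail (trunc e k).seq (n₀ + l) i = a i) ∧
      tail (trunc e k).seq (n₀ + l) j < a j := by
    rcases lt_or_ge (n₀ + l) (-k) with hn | hn
    · refine ⟨0, Nat.zero_le _, by simp, ?_⟩
      rw [tail, trunc_seq, if_neg (by rw [Finset.mem_Icc]; omega)]
      exact ha.zero_pos
    · refine exists_first_lt (hadm (n₀ + l)) ?_
      rw [tail, trunc_seq, if_neg (by rw [Finset.mem_Icc]; omega)]
      exact haJ.ne
  exact ⟨j, fun i hi => (h1 i hi).trans (hmatch i (by omega)).symm,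
    h2.trans_eq (hmatch j (by omega)).symm⟩

end

/-! ### The coding map of a homoclinic point -/

section
variable {M : GL (Fin 2) ℤ}

/-- The vectors `w` and `s` represent `t` on the expanding and on the contracting eigenline. -/
structure IsEigenRep (M : GL (Fin 2) ℤ) (t : Torus) (w s : Fin 2 → ℝ) : Prop where
  mulVec_w : (realMat M).mulVec w = lam M • w
  mulVec_s : (realMat M).mulVec s = lamConj M • s
  proj_w : proj w = t
  proj_s : proj s = t

theorem IsHomoclinic.exists_isEigenRep (hM : IsHyperbolic M) (hr : 0 < tr M) {t : Torus}
    (ht : IsHomoclinic M t) : ∃ w s, IsEigenRep M t w s := by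
  obtain ⟨⟨w, hw, hwt⟩, s, hs, hst⟩ := ht.exists_eigenvectors hM hr
  exact ⟨w, s, hw, hs, hwt, hst⟩

theorem sum_Icc_neg_natCast {A : Type*} [AddCommMonoid A] (f : ℤ → A) (k l : ℕ) :
    ∑ n ∈ Finset.Icc (-(k : ℤ)) l, f n = f 0 + ∑ n ∈ Finset.range l, f (n + 1) +
      ∑ n ∈ Finset.range k, f (-(n + 1)) := by
  induction k with
  | zero =>
    induction l with
    | zero => simp
    | succ l ih =>
      have h : Finset.Icc (-((0 : ℕ) : ℤ)) ((l + 1 : ℕ) : ℤ) =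
          insert ((l : ℤ) + 1) (Finset.Icc (-((0 : ℕ) : ℤ)) l) := by
        ext n
        simp only [Finset.mem_Icc, Finset.mem_insert]
        omega
      rw [h, Finset.sum_insert (by simp), ih, Finset.sum_range_succ]
      simp only [Finset.range_zero, Finset.sum_empty, add_zero]
      abel
  | succ k ih =>
    have h : Finset.Icc (-((k + 1 : ℕ) : ℤ)) (l : ℤ) =
        insert (-((k : ℤ) + 1)) (Finset.Icc (-(k : ℤ)) l) := by
      ext n
      simp only [Finset.mem_Icc, Finset.mem_insert]
      omega
    rw [h, Finset.sum_insert (by simp), ih, Finset.sum_range_succ]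
    abel

theorem IsEigenRep.w_ne_zero {t : Torus} {w s : Fin 2 → ℝ} (h : IsEigenRep M t w s)
    (ht : t ≠ 0) : w ≠ 0 := by
  rintro rfl
  exact ht (h.proj_w.symm.trans proj_zero)

/-- The projection as a homomorphism. -/
def projHom : (Fin 2 → ℝ) →+ Torus where
  toFun := proj
  map_zero' := proj_zero
  map_add' := proj_add

section rep
variable (hM : IsHyperbolic M) (hr : 0 < tr M) {t : Torus} {w s : Fin 2 → ℝ}
  (h : IsEigenRep M t w s)
include hM hr h

theorem IsEigenRep.toralAut_zpow (n : ℤ) : toralAut (M ^ n) t = proj (lam M ^ n • w) := by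
  rw [← h.proj_w, toralAut_zpow_proj (hM.lam_pos hr).ne' h.mulVec_w]

theorem IsEigenRep.toralAut_zpow' (n : ℤ) : toralAut (M ^ n) t = proj (lamConj M ^ n • s) := by
  rw [← h.proj_s, toralAut_zpow_proj (hM.lamConj_ne_zero hr) h.mulVec_s]

theorem IsEigenRep.sum_eq_proj (f : ℤ → ℕ) (S : Finset ℤ) :
    ∑ n ∈ S, f n • toralAut (M ^ (-n)) t = proj ((∑ n ∈ S, (f n : ℝ) * lam M ^ (-n)) • w) := by
  change _ = projHom _
  rw [Finset.sum_smul, map_sum]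
  refine Finset.sum_congr rfl fun n _ => ?_
  rw [h.toralAut_zpow hM hr, mul_smul, Nat.cast_smul_eq_nsmul, map_nsmul]
  rfl

/-- The terms with `n ≥ 0` are lifted to multiples of `w` and those with `n < 0` to multiples of
`s`; then each half converges absolutely in the plane. -/
theorem IsEigenRep.tendsto_sum (e : PrimarySpace M) :
    Tendsto (fun p : ℕ × ℕ => ∑ n ∈ Finset.Icc (-(p.1 : ℤ)) (p.2 : ℤ),
      e.seq n • toralAut (M ^ (-n)) t) atTop
      (𝓝 (proj (expandSum e • w + contractSum e • s))) := by
  have hsum : ∀ p : ℕ × ℕ, ∑ n ∈ Finset.Icc (-(p.1 : ℤ)) (p.2 : ℤ),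
      e.seq n • toralAut (M ^ (-n)) t = proj
        ((e.seq 0 + ∑ n ∈ Finset.range p.2, (e.seq (n + 1) : ℝ) * (lam M)⁻¹ ^ (n + 1)) • w +
        (∑ n ∈ Finset.range p.1, (e.seq (-(n + 1)) : ℝ) * lamConj M ^ (n + 1)) • s) := by
    intro p
    rw [sum_Icc_neg_natCast]
    change _ = projHom _
    rw [add_smul, Finset.sum_smul, Finset.sum_smul, map_add, map_add, map_sum, map_sum,
      Nat.cast_smul_eq_nsmul, map_nsmul]
    congr 1
    · congr 1
      · rw [neg_zero, zpow_zero, toralAut_one, ← h.proj_w]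
        rfl
      · refine Finset.sum_congr rfl fun n _ => ?_
        rw [h.toralAut_zpow hM hr, mul_smul, Nat.cast_smul_eq_nsmul, map_nsmul]
        have : lam M ^ (-((n : ℤ) + 1)) = (lam M)⁻¹ ^ (n + 1) := by
          rw [zpow_neg, inv_pow]
          norm_cast
        rw [this]
        rfl
    · refine Finset.sum_congr rfl fun n _ => ?_
      rw [h.toralAut_zpow' hM hr, mul_smul, Nat.cast_smul_eq_nsmul, map_nsmul, neg_neg]
      have : lamConj M ^ ((n : ℤ) + 1) = lamConj M ^ (n + 1) := by norm_cast
      rw [this]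
      rfl
  simp only [hsum]
  refine (continuous_proj.tendsto _).comp (Tendsto.add (Tendsto.smul_const ?_ _)
    (Tendsto.smul_const ?_ _))
  · refine tendsto_const_nhds.add (e.summable_pos.hasSum.tendsto_sum_nat.comp ?_)
    rw [← prod_atTop_atTop_eq]
    exact tendsto_snd
  · refine (summable_contract (hM.abs_lamConj hr) e).hasSum.tendsto_sum_nat.comp ?_
    rw [← prod_atTop_atTop_eq]
    exact tendsto_fst

theorem IsEigenRep.codingMap_eq (e : PrimarySpace M) :
    codingMap M t e = proj (expandSum e • w + contractSum e • s) :=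
  ((h.tendsto_sum hM hr e).comp (tendsto_atTop_diagonal (α := ℕ))).limUnder_eq

/-- When the two-sided real series itself converges, as for sequences vanishing far to the left, the
value is read off on the expanding line alone. -/
theorem IsEigenRep.codingMap_eq_proj {e : PrimarySpace M} {x : ℝ}
    (hx : Tendsto (fun p : ℕ × ℕ => ∑ n ∈ Finset.Icc (-(p.1 : ℤ)) (p.2 : ℤ),
      (e.seq n : ℝ) * lam M ^ (-n)) atTop (𝓝 x)) : codingMap M t e = proj (x • w) := by
  have h1 := h.tendsto_sum hM hr e
  rw [← h.codingMap_eq hM hr] at h1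
  refine tendsto_nhds_unique h1 ?_
  simp only [h.sum_eq_proj hM hr]
  exact (continuous_proj.tendsto _).comp (hx.smul_const w)

theorem IsEigenRep.isEquivariantHom : IsEquivariantHom (codingMap M t) where
  continuous := by
    have : codingMap M t = fun e => proj (expandSum e • w + contractSum e • s) :=
      funext (h.codingMap_eq hM hr)
    rw [this]
    exact continuous_proj.comp ((continuous_expandSum.smul continuous_const).add
      ((continuous_contractSum (hM.abs_lamConj hr)).smul continuous_const))
  map_add e e' := by
    rw [h.codingMap_eq hM hr, h.codingMap_eq hM hr, h.codingMap_eq hM hr, expandSum_add,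
      contractSum_add (hM.abs_lamConj hr), ← proj_add]
    congr 1
    module
  map_shift e := by
    rw [h.codingMap_eq hM hr, h.codingMap_eq hM hr, toralAut_proj,
      expandSum_shift (hM.lam_pos hr).ne', contractSum_shift (hM.abs_lamConj hr)]
    change _ = proj ((realMat M).mulVec _)
    rw [Matrix.mulVec_add, Matrix.mulVec_smul, Matrix.mulVec_smul, h.mulVec_w, h.mulVec_s,
      ← sub_eq_zero, ← proj_sub]
    -- The digit that crosses the origin changes from a multiple of `λ w` to one of `lamConj M • s`;
    -- both vectors represent `T t`.
    have h1 : (lam M * (expandSum e - e.seq 0)) • w +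
        (lamConj M * (e.seq 0 + contractSum e)) • s -
        (expandSum e • lam M • w + contractSum e • lamConj M • s) =
        e.seq 0 • (lamConj M • s) - e.seq 0 • (lam M • w) := by
      module
    have h2 := h.toralAut_zpow hM hr 1
    rw [h.toralAut_zpow' hM hr, zpow_one, zpow_one] at h2
    rw [h1, proj_sub, proj_nsmul, proj_nsmul, h2, sub_self]

theorem IsEigenRep.codingMap_single_zero : codingMap M t (single M 0) = t := by
  rw [h.codingMap_eq hM hr]
  have h1 : expandSum (single M 0) = 1 := by
    rw [expandSum, PrimarySpace.sumPos, single_seq, if_pos rfl, Nat.cast_one, add_eq_left,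
      ← tsum_zero (α := ℝ) (β := ℕ)]
    congr 1
    ext n
    rw [single_seq, if_neg (by omega)]
    simp
  have h2 : contractSum (single M 0) = 0 := by
    rw [contractSum, ← tsum_zero (α := ℝ) (β := ℕ)]
    congr 1
    ext n
    rw [single_seq, if_neg (by omega)]
    simp
  rw [h1, h2, one_smul, zero_smul, add_zero, h.proj_w]

theorem IsEigenRep.proj_smul_inj (ht : t ≠ 0) {x y : ℝ} (hxy : proj (x • w) = proj (y • w)) :
    x = y := by
  have h1 : proj ((x - y) • w) = 0 := by rw [sub_smul, proj_sub, hxy, sub_self]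
  have h2 := eq_zero_of_mulVec_eq hM hr (by rw [Matrix.mulVec_smul, h.mulVec_w, smul_comm]) h1
  exact sub_eq_zero.1 ((smul_eq_zero.1 h2).resolve_right (h.w_ne_zero ht))

/-- The image is compact, hence closed, and it contains a dense half-line: each `x ≥ 0`, divided by
a large power of `λ`, has a greedy expansion. -/
theorem IsEigenRep.image_admissible (ht : t ≠ 0) :
    codingMap M t '' {e | Admissible (critSeq M) e.seq} = Set.univ := by
  have hcrit := isCritical_critSeq hM hr
  have hl := hM.one_lt_lam hr
  have hpos := hM.lam_pos hr
  have hcompact : IsCompact {e : PrimarySpace M | Admissible (critSeq M) e.seq} :=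
    isCompact_of_isClosed_of_le hl (isClosed_admissible (critSeq M)) fun f hf n => hf.le_zero n
  have hclosed := (hcompact.image (h.isEquivariantHom hM hr).continuous).isClosed
  rw [← hclosed.closure_eq]
  refine ((dense_proj_halfLine hM hr h.mulVec_w (h.w_ne_zero ht)).mono ?_).closure_eq
  rintro _ ⟨x, hx, rfl⟩
  obtain ⟨K, hK⟩ := pow_unbounded_of_one_lt x hl
  have hK' : x < lam M ^ (K + 1) :=
    hK.trans_le (pow_le_pow_right₀ hl.le (Nat.le_succ K))
  obtain ⟨b, hb, hbs⟩ := hcrit.exists_expansion (x := x / lam M ^ (K + 1))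
    (div_nonneg hx (by positivity)) ((div_lt_one (by positivity)).2 hK')
  have hadm := hb.zeroExtend hcrit.zero_pos K
  refine ⟨⟨zeroExtend K b, mem_primarySubmonoid_of_le hl hadm.le_zero⟩, hadm, ?_⟩
  refine h.codingMap_eq_proj hM hr ?_
  have h1 := tendsto_sum_Icc hpos (e := zeroExtend K b) (K := K) (s := x / lam M ^ (K + 1))
    (fun n hn => zeroExtend_of_lt hn) (by simpa only [zeroExtend_add] using hbs)
  rwa [mul_div_cancel₀ _ (by positivity)] at h1

/-- Finite sequences map to points of the expanding line, which injects into the torus, and there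
the value determines an admissible finite word. -/
theorem IsEigenRep.injOn_finite (ht : t ≠ 0) :
    Set.InjOn (codingMap M t) ({e | Admissible (critSeq M) e.seq} ∩ finiteSeqs M) := by
  have hcrit := isCritical_critSeq hM hr
  have hpos := hM.lam_pos hr
  rintro e ⟨he, hef⟩ e' ⟨he', hef'⟩ heq
  obtain ⟨K, hK⟩ : ∃ K : ℕ, ∀ n : ℤ, n < -K ∨ K < n → e.seq n = 0 ∧ e'.seq n = 0 := by
    obtain ⟨K, hK⟩ := ((hef.union hef').image Int.natAbs).bddAbove
    refine ⟨K, fun n hn => ?_⟩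
    by_contra hne
    have := hK ⟨n, by
      rw [not_and_or] at hne
      exact hne, rfl⟩
    omega
  have key : ∀ f : PrimarySpace M, (∀ n : ℤ, n < -K ∨ K < n → f.seq n = 0) →
      (∀ k, 2 * K + 1 ≤ k → f.seq (-K + k) = 0) ∧
      codingMap M t f =
        proj ((lam M ^ (K + 1) * digitSum (lam M) (fun k => f.seq (-K + k))) • w) := by
    intro f hf
    have h0 : ∀ k : ℕ, 2 * K + 1 ≤ k → f.seq (-K + k) = 0 := fun k hk => hf _ (by omega)
    exact ⟨fun k hk => hf _ (by omega), h.codingMap_eq_proj hM hr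
      (tendsto_sum_Icc hpos (fun n hn => hf n (Or.inl hn))
        (summable_digits_of_eventually_zero h0).hasSum)⟩
  obtain ⟨h1, h2⟩ := key e fun n hn => (hK n hn).1
  obtain ⟨h3, h4⟩ := key e' fun n hn => (hK n hn).2
  rw [h2, h4] at heq
  have h5 := mul_left_cancel₀ (by positivity) (h.proj_smul_inj hM hr ht heq)
  have h6 := hcrit.digitSum_injective (fun k hk => h1 k (by exact_mod_cast hk))
    (fun k hk => h3 k (by exact_mod_cast hk)) (he.tailsLE _) (he'.tailsLE _) h5
  refine PrimarySpace.ext (funext fun n => ?_)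
  rcases lt_or_ge n (-K) with hn | hn
  · rw [(hK n (Or.inl hn)).1, (hK n (Or.inl hn)).2]
  · have := congrFun h6 (n + K).toNat
    have hn' : -(K : ℤ) + ((n + K).toNat : ℤ) = n := by omega
    rwa [hn'] at this

end rep

/-- An equivariant homomorphism as an additive homomorphism. -/
def IsEquivariantHom.toAddMonoidHom {φ : PrimarySpace M → Torus} (hφ : IsEquivariantHom φ) :
    PrimarySpace M →+ Torus := AddMonoidHom.mk' φ hφ.map_add

theorem IsEquivariantHom.map_single {φ : PrimarySpace M → Torus} (hφ : IsEquivariantHom φ)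
    (n : ℤ) : φ (single M n) = toralAut (M ^ (-n)) (φ (single M 0)) := by
  have hstep : ∀ n, φ (single M n) = toralAut M (φ (single M (n + 1))) := fun n => by
    rw [← hφ.map_shift, shift_single]
  induction n using Int.induction_on with
  | zero => simp [toralAut_one]
  | succ n ih =>
    have h1 := congrArg (toralAut M⁻¹) (hstep n)
    rw [toralAut_inv_toralAut, ih, ← toralAut_mul] at h1
    rw [← h1, neg_add, add_comm, zpow_add, zpow_neg_one]
  | pred n ih =>
    rw [hstep, sub_add_cancel, ih, ← toralAut_mul, neg_sub, sub_neg_eq_add, neg_neg, zpow_add,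
      zpow_one]

theorem IsEquivariantHom.eq_of_single_zero {φ ψ : PrimarySpace M → Torus}
    (hφ : IsEquivariantHom φ) (hψ : IsEquivariantHom ψ)
    (h : φ (single M 0) = ψ (single M 0)) : φ = ψ := by
  have htrunc : ∀ (χ : PrimarySpace M → Torus), IsEquivariantHom χ → ∀ e k,
      χ (trunc e k) = ∑ n ∈ Finset.Icc (-(k : ℤ)) k,
        e.seq n • toralAut (M ^ (-n)) (χ (single M 0)) := by
    intro χ hχ e k
    change hχ.toAddMonoidHom (trunc e k) = _
    rw [trunc, map_sum]
    refine Finset.sum_congr rfl fun n _ => ?_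
    rw [map_nsmul, ← hχ.map_single]
    rfl
  funext e
  refine tendsto_nhds_unique ((hφ.continuous.tendsto e).comp (tendsto_trunc e))
    (((hψ.continuous.tendsto e).comp (tendsto_trunc e)).congr fun k => ?_)
  rw [Function.comp_apply, Function.comp_apply, htrunc φ hφ, htrunc ψ hψ, h]

/-- The orbit of this point is the image of the unit sequences, which tend to zero at both ends. -/
theorem IsEquivariantHom.isHomoclinic {φ : PrimarySpace M → Torus} (hl : 1 < lam M)
    (hφ : IsEquivariantHom φ) : IsHomoclinic M (φ (single M 0)) := by
  have h0 : φ 0 = 0 := map_zero hφ.toAddMonoidHom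
  have h1 := hφ.continuous.tendsto 0
  rw [h0] at h1
  have h2 : ∀ n : ℤ, φ (single M (-n)) = toralAut (M ^ n) (φ (single M 0)) := fun n => by
    rw [hφ.map_single, neg_neg]
  constructor
  · exact (h1.comp ((tendsto_single_atBot hl).comp tendsto_neg_atTop_atBot)).congr h2
  · exact (h1.comp ((tendsto_single_atTop hl).comp tendsto_neg_atBot_atTop)).congr h2

end

/-! ### Uniqueness of the symbolic set -/

section
variable {M : GL (Fin 2) ℤ}

/-- The finite sequence with the digits `c 0, …, c (L - 1)` at the positions `0, …, L - 1`. -/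
noncomputable def finiteWord (M : GL (Fin 2) ℤ) (c : ℕ → ℕ) (L : ℕ) : PrimarySpace M :=
  ∑ i ∈ Finset.range L, c i • single M i

theorem finiteWord_seq (c : ℕ → ℕ) (L : ℕ) (m : ℤ) :
    (finiteWord M c L).seq m = if 0 ≤ m ∧ m < L then c m.toNat else 0 := by
  change seqHom M (finiteWord M c L) m = _
  rw [finiteWord, map_sum, Finset.sum_apply]
  have h : ∀ i, seqHom M (c i • single M i) m = if m = i then c i else 0 := fun i => by
    rw [map_nsmul, Pi.smul_apply]
    change c i • (single M i).seq m = _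
    rw [single_seq]
    simp
  simp only [h]
  split_ifs with hm
  · obtain ⟨k, rfl⟩ := Int.eq_ofNat_of_zero_le hm.1
    simp only [Int.toNat_natCast, Nat.cast_inj, Finset.sum_ite_eq]
    rw [if_pos (by rw [Finset.mem_range]; omega)]
  · refine Finset.sum_eq_zero fun i hi => if_neg ?_
    rw [Finset.mem_range] at hi
    omega

theorem single_mem_finiteSeqs (n : ℤ) : single M n ∈ finiteSeqs M := by
  refine (Set.finite_singleton n).subset fun m hm => ?_
  by_contra hne
  exact hm ((single_seq n m).trans (if_neg hne))

theorem finiteSeqs_add {e e' : PrimarySpace M} (he : e ∈ finiteSeqs M) (he' : e' ∈ finiteSeqs M) :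
    e + e' ∈ finiteSeqs M :=
  (he.union he').subset (Function.support_add _ _)

theorem finiteWord_mem_finiteSeqs (c : ℕ → ℕ) (L : ℕ) : finiteWord M c L ∈ finiteSeqs M := by
  refine (Set.finite_Ico (0 : ℤ) L).subset fun m hm => ?_
  by_contra hne
  exact hm ((finiteWord_seq c L m).trans (if_neg hne))

section rep
variable (hM : IsHyperbolic M) (hr : 0 < tr M) {t : Torus} {w s : Fin 2 → ℝ}
  (h : IsEigenRep M t w s)
include hM hr h

theorem IsEigenRep.codingMap_single (n : ℤ) :
    codingMap M t (single M n) = proj (lam M ^ (-n) • w) := by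
  rw [(h.isEquivariantHom hM hr).map_single, h.codingMap_single_zero hM hr,
    h.toralAut_zpow hM hr]

theorem IsEigenRep.codingMap_finiteWord (c : ℕ → ℕ) (L : ℕ) :
    codingMap M t (finiteWord M c L) =
      proj ((∑ i ∈ Finset.range L, (c i : ℝ) * lam M ^ (-(i : ℤ))) • w) := by
  change (h.isEquivariantHom hM hr).toAddMonoidHom _ = projHom _
  rw [finiteWord, map_sum, Finset.sum_smul, map_sum]
  refine Finset.sum_congr rfl fun i _ => ?_
  rw [map_nsmul, mul_smul, Nat.cast_smul_eq_nsmul, map_nsmul]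
  exact congrArg (c i • ·) (h.codingMap_single hM hr i)

omit hM hr h in
/-- In an arithmetic coding, two finite sequences with the same image are equal if all their tails
are dominated by one tail of a sequence of the coding. -/
theorem IsArithmeticCoding.eq_of_lexLE {φ : PrimarySpace M → Torus} {X : Set (PrimarySpace M)}
    (hφ : IsArithmeticCoding φ X) {e f g : PrimarySpace M} (he : e ∈ X) (n : ℤ)
    (hf : f ∈ finiteSeqs M) (hg : g ∈ finiteSeqs M) (hfg : φ f = φ g)
    (hfe : ∀ m, LexLE (tail f.seq m) (tail e.seq n))
    (hge : ∀ m, LexLE (tail g.seq m) (tail e.seq n)) : f = g :=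
  hφ.injective_on_finite ⟨hφ.total e he f ⟨n, fun _ => hfe _⟩, hf⟩
    ⟨hφ.total e he g ⟨n, fun _ => hge _⟩, hg⟩ hfg

/-- A violation starts with at least `r 1` lexicographically. It therefore dominates the word `r 1`
and also a single `1` one place earlier, and `λ = r + λ⁻¹` gives these the same image. -/
theorem IsEigenRep.subset_markov (hd : dt M = -1) {X : Set (PrimarySpace M)}
    (hX : IsArithmeticCoding (codingMap M t) X) {e : PrimarySpace M} (he : e ∈ X) :
    e.seq ∈ markovCompactum (tr M) := by
  have hpos := hM.lam_pos hr
  have hsq := hM.lam_sq hr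
  by_contra hne
  rw [markovCompactum, Set.mem_ofPred_eq, not_forall] at hne
  obtain ⟨n, hn⟩ := hne
  have hn' : tr M < e.seq n ∨ ((e.seq n : ℤ) = tr M ∧ 1 ≤ e.seq (n + 1)) := by
    by_contra! hcon
    refine hn ⟨hcon.1, fun h1 => ?_⟩
    have := hcon.2 h1
    omega
  set c : ℕ → ℕ := fun i => if i = 0 then (tr M).toNat else 1 with hc
  have hseq : ∀ m, (finiteWord M c 2).seq m =
      if m = 0 then (tr M).toNat else if m = 1 then 1 else 0 := by
    intro m
    rw [finiteWord_seq]
    split_ifs with h1 h2 h3 h2 h3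
    · simp [h2, hc]
    · simp [h3, hc]
    · omega
    · omega
    · omega
    · rfl
  have heq : finiteWord M c 2 = single M (-1) := by
    refine hX.eq_of_lexLE he n (finiteWord_mem_finiteSeqs _ _) (single_mem_finiteSeqs _) ?_ ?_ ?_
    · rw [h.codingMap_finiteWord hM hr, h.codingMap_single hM hr]
      congr 2
      have hcast : ((tr M).toNat : ℝ) = tr M := by exact_mod_cast Int.toNat_of_nonneg hr.le
      rw [hd] at hsq
      simp only [Finset.sum_range_succ, Finset.sum_range_zero, hc, if_true, one_ne_zero, if_false,
        hcast, Nat.cast_zero, zpow_zero, Nat.cast_one, zpow_neg, zpow_one, neg_neg]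
      field_simp
      push_cast at hsq
      linear_combination -hsq
    · intro m
      refine lexLE_iff.2 fun j hj => ?_
      simp only [tail, hseq] at hj ⊢
      rcases Nat.lt_or_ge 0 j with hj0 | hj0
      · have h0 := hj 0 hj0
        simp only [Nat.cast_zero, add_zero] at h0
        rcases Nat.lt_or_ge 1 j with hj1 | hj1
        · rw [if_neg (by split_ifs at h0 <;> omega), if_neg (by split_ifs at h0 <;> omega)]
          exact Nat.zero_le _
        · obtain rfl : j = 1 := by omega
          push_cast
          split_ifs at h0 ⊢ <;> omega
      · obtain rfl : j = 0 := by omega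
        simp only [Nat.cast_zero, add_zero]
        split_ifs <;> omega
    · intro m
      refine lexLE_iff.2 fun j hj => ?_
      simp only [tail, single_seq] at hj ⊢
      rcases Nat.lt_or_ge 0 j with hj0 | hj0
      · have h0 := hj 0 hj0
        simp only [Nat.cast_zero, add_zero] at h0
        split_ifs at h0 ⊢ <;> omega
      · obtain rfl : j = 0 := by omega
        simp only [Nat.cast_zero, add_zero]
        split_ifs <;> omega
  -- The two words differ at position `-1`, where the digits are 0 and 1.
  have h1 := hseq (-1)
  rw [heq, single_seq] at h1
  simp at h1

omit h in
/-- The words `(r-1)(r-2)^k(r-1)` and `1 0^{k+2} 1`, the second one starting one position earlier,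
have the same value. -/
theorem sofic_word_identity (hd : dt M = 1) (k : ℕ) :
    ∑ i ∈ Finset.range (k + 2),
      ((if i = 0 ∨ i = k + 1 then (tr M).toNat - 1 else (tr M).toNat - 2 : ℕ) : ℝ) *
        lam M ^ (-(i : ℤ)) = lam M + lam M ^ (-((k : ℤ) + 2)) := by
  have hpos := hM.lam_pos hr
  have hsq := hM.lam_sq hr
  have h3 := hM.three_le_tr hr hd
  rw [hd] at hsq
  have hcast : ((tr M).toNat : ℝ) = tr M := by exact_mod_cast Int.toNat_of_nonneg hr.le
  have hc1 : (((tr M).toNat - 1 : ℕ) : ℝ) = tr M - 1 := by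
    rw [Nat.cast_sub (by omega), hcast, Nat.cast_one]
  have hc2 : (((tr M).toNat - 2 : ℕ) : ℝ) = tr M - 2 := by
    rw [Nat.cast_sub (by omega), hcast, Nat.cast_ofNat]
  have hstep : ∀ k : ℕ, lam M ^ (-((k : ℤ) + 1)) = lam M * lam M ^ (-((k : ℤ) + 2)) := fun k => by
    rw [← zpow_one_add₀ hpos.ne']
    congr 1
  -- The last digit `r - 1` is split off, so that the induction step changes only the last two
  -- places.
  have hinit : ∀ k : ℕ, ∑ i ∈ Finset.range (k + 1),
      ((if i = 0 then (tr M).toNat - 1 else (tr M).toNat - 2 : ℕ) : ℝ) * lam M ^ (-(i : ℤ)) +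
      (tr M - 1) * lam M ^ (-((k : ℤ) + 1)) = lam M + lam M ^ (-((k : ℤ) + 2)) := by
    intro k
    induction k with
    | zero =>
      simp only [zero_add, Finset.sum_range_one, if_true, hc1, Nat.cast_zero, zpow_zero, zpow_neg,
        zpow_one]
      norm_cast
      field_simp
      push_cast at hsq ⊢
      linear_combination (-lam M - 1) * hsq
    | succ k ih =>
      rw [Finset.sum_range_succ, if_neg (Nat.succ_ne_zero k), hc2]
      have h4 := hstep k
      have h5 := hstep (k + 1)
      push_cast at h4 h5
      simp only [Nat.cast_add, Nat.cast_one]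
      have e1 : (k : ℤ) + 1 + 1 = k + 2 := by ring
      have e2 : (k : ℤ) + 1 + 2 = k + 3 := by ring
      rw [e1, e2] at h5
      rw [e1, e2]
      rw [h4, h5] at ih ⊢
      push_cast at hsq
      linear_combination ih - lam M ^ (-((k : ℤ) + 3)) * hsq
  rw [← hinit k, Finset.sum_range_succ, if_pos (Or.inr rfl), hc1]
  congr 1
  · refine Finset.sum_congr rfl fun i hi => ?_
    rw [Finset.mem_range] at hi
    have : (i = 0 ∨ i = k + 1) ↔ i = 0 := by omega
    simp only [this]

/-- A violation dominates a word `(r-1)(r-2)^k(r-1)` and also `1 0^{k+2} 1` begun one place earlier.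
These have equal images by `sofic_word_identity`. -/
theorem IsEigenRep.subset_sofic (hd : dt M = 1) {X : Set (PrimarySpace M)}
    (hX : IsArithmeticCoding (codingMap M t) X) {e : PrimarySpace M} (he : e ∈ X) :
    e.seq ∈ soficCompactum (tr M) := by
  have h3 := hM.three_le_tr hr hd
  by_contra hne
  rw [soficCompactum, Set.mem_ofPred_eq, not_forall] at hne
  obtain ⟨n, hn⟩ := hne
  -- A digit at least `r` exceeds every digit of both words, so in that case any `k` serves.
  obtain ⟨k, hk⟩ : ∃ k : ℕ, tr M ≤ e.seq n ∨ ((e.seq n : ℤ) = tr M - 1 ∧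
      (∀ j : ℕ, 1 ≤ j → j ≤ k → (e.seq (n + j) : ℤ) = tr M - 2) ∧
      (e.seq (n + k + 1) : ℤ) = tr M - 1) := by
    by_contra! hcon
    refine hn ⟨by have := (hcon 0).1; omega, fun k hk => ?_⟩
    exact (hcon k).2 hk.1 hk.2.1 hk.2.2
  set c : ℕ → ℕ := fun i => if i = 0 ∨ i = k + 1 then (tr M).toNat - 1 else (tr M).toNat - 2
    with hc
  have hseq : ∀ m, (finiteWord M c (k + 2)).seq m =
      if m = 0 ∨ m = k + 1 then (tr M).toNat - 1 else
        if 1 ≤ m ∧ m ≤ k then (tr M).toNat - 2 else 0 := by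
    intro m
    rw [finiteWord_seq]
    push_cast
    simp only [hc]
    split_ifs <;> omega
  have hgseq : ∀ m, (single M (-1) + single M (k + 2)).seq m =
      if m = -1 ∨ m = k + 2 then 1 else 0 := by
    intro m
    rw [PrimarySpace.seq_add, Pi.add_apply, single_seq, single_seq]
    split_ifs <;> omega
  have heq : finiteWord M c (k + 2) = single M (-1) + single M (k + 2) := by
    refine hX.eq_of_lexLE he n (finiteWord_mem_finiteSeqs _ _)
      (finiteSeqs_add (single_mem_finiteSeqs _) (single_mem_finiteSeqs _)) ?_ ?_ ?_
    · rw [h.codingMap_finiteWord hM hr, hX.hom.map_add, h.codingMap_single hM hr,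
        h.codingMap_single hM hr, sofic_word_identity hM hr hd, ← proj_add, ← add_smul, neg_neg,
        zpow_one]
    · intro m
      refine lexLE_iff.2 fun j hj => ?_
      simp only [tail, hseq] at hj ⊢
      rcases Nat.lt_or_ge 0 j with hj0 | hj0
      · have h0 := hj 0 hj0
        simp only [Nat.cast_zero, add_zero] at h0
        have hk' : m = 0 ∨ m = k + 1 := by
          by_contra hm
          rw [if_neg hm] at h0
          split_ifs at h0 <;> omega
        rw [if_pos hk'] at h0
        obtain ⟨-, hk2, hk3⟩ := hk.resolve_left (by omega)
        rcases hk' with rfl | rfl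
        · rcases lt_trichotomy j (k + 1) with hjk | rfl | hjk
          · have := hk2 j hj0 (by omega)
            split_ifs <;> omega
          · have h5 : n + ((k + 1 : ℕ) : ℤ) = n + k + 1 := by push_cast; ring
            rw [h5]
            split_ifs <;> omega
          · split_ifs <;> omega
        · split_ifs <;> omega
      · obtain rfl : j = 0 := by omega
        simp only [Nat.cast_zero, add_zero]
        split_ifs <;> omega
    · intro m
      refine lexLE_iff.2 fun j hj => ?_
      simp only [tail, hgseq] at hj ⊢
      rcases Nat.lt_or_ge 0 j with hj0 | hj0
      · have h0 := hj 0 hj0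
        simp only [Nat.cast_zero, add_zero] at h0
        split_ifs at h0 <;> omega
      · obtain rfl : j = 0 := by omega
        simp only [Nat.cast_zero, add_zero]
        split_ifs <;> omega
  have h1 := hseq (-1)
  rw [heq, hgseq] at h1
  split_ifs at h1 <;> omega

theorem IsEigenRep.subset_admissible {X : Set (PrimarySpace M)}
    (hX : IsArithmeticCoding (codingMap M t) X) :
    X ⊆ {e | Admissible (critSeq M) e.seq} := by
  intro e he
  refine (mem_compactum_iff hM hr).1 ?_
  rcases dt_eq_one_or M with hd | hd
  · rw [compactum, if_neg (by omega)]
    exact h.subset_sofic hM hr hd hX he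
  · rw [compactum, if_pos hd]
    exact h.subset_markov hM hr hd hX he

omit h in
theorem expandSum_eq_digitSum (e : PrimarySpace M) :
    expandSum e = lam M * digitSum (lam M) (fun k => e.seq k) := by
  have hpos := hM.lam_pos hr
  have hs : Summable (fun k : ℕ => (e.seq k : ℝ) * (lam M)⁻¹ ^ (k + 1)) := by
    rw [← summable_nat_add_iff 1]
    refine (e.summable_pos.mul_right (lam M)⁻¹).congr fun k => ?_
    push_cast
    ring
  rw [digitSum, ← hs.sum_add_tsum_nat_add 1, mul_add, ← tsum_mul_left, expandSum,
    PrimarySpace.sumPos]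
  congr 1
  · simp only [Finset.sum_range_one, Nat.cast_zero, zero_add, pow_one]
    field_simp
  · congr 1
    ext k
    push_cast
    rw [pow_succ _ (k + 1)]
    field_simp

open MeasureTheory Pointwise in
/-- A set of admissible sequences that covers the torus matches arbitrarily long beginnings of the
critical sequence. -/
theorem IsEigenRep.exists_matching (ht : t ≠ 0) {X : Set (PrimarySpace M)}
    (hX : X ⊆ {e | Admissible (critSeq M) e.seq}) (hsurj : codingMap M t '' X = Set.univ)
    (m : ℕ) : ∃ e ∈ X, ∃ n : ℤ, ∀ i : ℕ, i < m → e.seq (n + i) = critSeq M i := by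
  by_contra! hcon
  have hl := hM.one_lt_lam hr
  have hpos := hM.lam_pos hr
  have hw0 := (exists_slope hM hr h.mulVec_w (h.w_ne_zero ht)).1
  set E := digitSum (lam M) '' {b | ∀ n, ∃ j < m, (∀ i < j, b (n + i) = critSeq M i) ∧
    b (n + j) < critSeq M j} with hE
  have hnull : volume E = 0 := (isCritical_critSeq hM hr).volume_image_digitSum m
  -- Without a match of length `m`, every tail of an admissible sequence drops below the critical
  -- sequence within `m` steps.
  have hmem : ∀ e ∈ X, digitSum (lam M) (fun k => e.seq k) ∈ E := by
    intro e he
    refine ⟨_, fun n => ?_, rfl⟩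
    obtain ⟨i, hi, hne⟩ := hcon e he n
    obtain ⟨j, hj, h1, h2⟩ := exists_first_lt (b := fun k : ℕ => e.seq (n + k)) (hX he n) hne
    refine ⟨j, hj.trans_lt hi, fun i hi => ?_, ?_⟩
    · exact_mod_cast h1 i hi
    · exact_mod_cast h2
  have hdiff : lam M - lamConj M ≠ 0 := by
    have h1 := hM.abs_lamConj hr
    have h2 := le_abs_self (lamConj M)
    have h3 := inv_lt_one_of_one_lt₀ hl
    linarith
  -- The coordinate along `w` in the eigenbasis: `ℓ w = 1` and `ℓ s = 0`.
  set ℓ : (Fin 2 → ℝ) → ℝ := fun v =>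
    ((realMat M).mulVec v 0 - lamConj M * v 0) / ((lam M - lamConj M) * w 0) with hℓ
  -- Coding the point of `y • w` and applying `ℓ` writes `y` as `ℓ` of an integer vector plus the
  -- expanding sum of a sequence in `X`. There are only countably many integer vectors.
  have hcover : (Set.univ : Set ℝ) ⊆ ⋃ z : Fin 2 → ℤ, (ℓ fun i => z i) +ᵥ (lam M • E) := by
    intro y _
    obtain ⟨e, he, hey⟩ : proj (y • w) ∈ codingMap M t '' X := by rw [hsurj]; trivial
    rw [h.codingMap_eq hM hr, ← sub_eq_zero, ← proj_sub] at hey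
    obtain ⟨z, hz⟩ := proj_eq_zero_iff.1 hey
    refine Set.mem_iUnion.2 ⟨-z, Set.mem_vadd_set.2
      ⟨lam M • digitSum (lam M) (fun k => e.seq k), Set.smul_mem_smul_set (hmem e he), ?_⟩⟩
    have hz' : (fun i => (((-z) i : ℤ) : ℝ)) =
        y • w - (expandSum e • w + contractSum e • s) := by
      funext i
      rw [Pi.neg_apply, Int.cast_neg, ← hz i]
      simp
    rw [hz', smul_eq_mul, ← expandSum_eq_digitSum hM hr, vadd_eq_add]
    simp only [hℓ, Matrix.mulVec_sub, Matrix.mulVec_add, Matrix.mulVec_smul, h.mulVec_w,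
      h.mulVec_s, Pi.sub_apply, Pi.add_apply, Pi.smul_apply, smul_eq_mul]
    field_simp
    ring
  have hzero : volume (Set.univ : Set ℝ) = 0 := by
    refine measure_mono_null hcover (measure_iUnion_null fun z => ?_)
    rw [measure_vadd, Measure.addHaar_smul, hnull, mul_zero]
  simp at hzero

theorem IsEigenRep.eq_admissible (ht : t ≠ 0) {X : Set (PrimarySpace M)}
    (hX : IsArithmeticCoding (codingMap M t) X) :
    X = {e | Admissible (critSeq M) e.seq} := by
  have hsub := h.subset_admissible hM hr hX
  exact hsub.antisymm (admissible_subset_of_matching (isCritical_critSeq hM hr) hX.closed hX.total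
    (h.exists_matching hM hr ht hsub hX.surjective))

theorem IsEigenRep.isArithmeticCoding (ht : t ≠ 0) :
    IsArithmeticCoding (codingMap M t) {e | Admissible (critSeq M) e.seq} where
  hom := h.isEquivariantHom hM hr
  closed := (isClosed_admissible _).preimage continuous_seq
  shift_invariant := by
    have hl := hM.one_lt_lam hr
    ext e
    constructor
    · rintro ⟨e, he, rfl⟩ n j hj
      simp only [shift_seq, add_right_comm _ _ (1 : ℤ)] at hj ⊢
      exact he (n + 1) j hj
    · intro he
      have hadm : Admissible (critSeq M) (fun n => e.seq (n - 1)) := by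
        intro n j hj
        simp only [add_sub_right_comm] at hj ⊢
        exact he (n - 1) j hj
      refine ⟨⟨_, mem_primarySubmonoid_of_le hl hadm.le_zero⟩, hadm, PrimarySpace.ext ?_⟩
      funext n
      exact congrArg e.seq (add_sub_cancel_right n 1)
  total := isTotal_admissible _
  surjective := h.image_admissible hM hr ht
  injective_on_finite := h.injOn_finite hM hr ht

end rep

/-! ### The bijections -/

section main
variable (hM : IsHyperbolic M) (hr : 0 < tr M)
include hM hr

theorem bijOn_codingMap :
    Set.BijOn (codingMap M) {t | IsHomoclinic M t} {φ | IsEquivariantHom φ} := by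
  refine ⟨fun t ht => ?_, fun t ht t' ht' heq => ?_, fun φ hφ => ?_⟩
  · obtain ⟨w, s, h⟩ := IsHomoclinic.exists_isEigenRep hM hr ht
    exact h.isEquivariantHom hM hr
  · obtain ⟨w, s, h⟩ := IsHomoclinic.exists_isEigenRep hM hr ht
    obtain ⟨w', s', h'⟩ := IsHomoclinic.exists_isEigenRep hM hr ht'
    rw [← h.codingMap_single_zero hM hr, heq, h'.codingMap_single_zero hM hr]
  · have ht := IsEquivariantHom.isHomoclinic (hM.one_lt_lam hr) hφ
    obtain ⟨w, s, h⟩ := ht.exists_isEigenRep hM hr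
    exact ⟨_, ht, (h.isEquivariantHom hM hr).eq_of_single_zero hφ
      (h.codingMap_single_zero hM hr)⟩

theorem existsUnique_isPlanarCoordinates {t : Torus} (ht : IsHomoclinic M t) :
    ∃! w, IsPlanarCoordinates M t w := by
  obtain ⟨w, s, h⟩ := ht.exists_isEigenRep hM hr
  refine ⟨w, ⟨h.mulVec_w, h.proj_w⟩, fun w' hw' => sub_eq_zero.1 ?_⟩
  have h1 : (realMat M).mulVec w' = lam M • w' := hw'.1
  refine eq_zero_of_mulVec_eq hM hr ?_ ?_
  · rw [Matrix.mulVec_sub, h1, h.mulVec_w, smul_sub]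
  · rw [proj_sub, hw'.2, h.proj_w, sub_self]

theorem setOf_seq_mem_compactum :
    {e : PrimarySpace M | e.seq ∈ compactum M} = {e | Admissible (critSeq M) e.seq} :=
  Set.ext fun _ => mem_compactum_iff hM hr

/-- Every arithmetic coding is given by a nonzero homoclinic point and the compactum. -/
theorem IsArithmeticCoding.exists_homoclinic {φ : PrimarySpace M → Torus}
    {X : Set (PrimarySpace M)} (hφ : IsArithmeticCoding φ X) :
    ∃ t, (IsHomoclinic M t ∧ t ≠ 0) ∧ codingMap M t = φ ∧
      X = {e | e.seq ∈ compactum M} := by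
  obtain ⟨t, ht, rfl⟩ := (bijOn_codingMap hM hr).surjOn hφ.hom
  obtain ⟨w, s, h⟩ := IsHomoclinic.exists_isEigenRep hM hr ht
  -- For `t = 0` the coding map vanishes identically and misses the point `(1/2, 1/2)`.
  have hne : t ≠ 0 := by
    rintro rfl
    have h0 : w = 0 := eq_zero_of_mulVec_eq hM hr h.mulVec_w h.proj_w
    have h1 : ∀ e, codingMap M 0 e = 0 := fun e => by
      refine tendsto_nhds_unique ?_ (tendsto_const_nhds (x := (0 : Torus))
        (f := (atTop : Filter (ℕ × ℕ))))
      have h2 := h.tendsto_sum hM hr e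
      rw [← h.codingMap_eq hM hr] at h2
      simpa only [h.sum_eq_proj hM hr, h0, smul_zero, proj_zero] using h2
    obtain ⟨e, -, he⟩ : (fun _ => ((1 / 2 : ℝ) : UnitAddCircle) : Torus) ∈ codingMap M 0 '' X := by
      rw [hφ.surjective]; trivial
    rw [h1] at he
    obtain ⟨n, hn⟩ := (AddCircle.coe_eq_zero_iff (1 : ℝ)).1 (congrFun he 0).symm
    rw [zsmul_eq_mul, mul_one, eq_div_iff two_ne_zero] at hn
    have : n * 2 = 1 := by exact_mod_cast hn
    omega
  refine ⟨t, ⟨ht, hne⟩, rfl, ?_⟩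
  rw [setOf_seq_mem_compactum hM hr]
  exact h.eq_admissible hM hr hne hφ

theorem bijOn_codingMap_compactum :
    Set.BijOn (fun t : Torus => (codingMap M t, {e : PrimarySpace M | e.seq ∈ compactum M}))
      {t | IsHomoclinic M t ∧ t ≠ 0} {c | IsArithmeticCoding c.1 c.2} := by
  refine ⟨fun t ht => ?_, fun t ht t' ht' heq => ?_, fun c hc => ?_⟩
  · obtain ⟨w, s, h⟩ := ht.1.exists_isEigenRep hM hr
    simp only [Set.mem_ofPred_eq, setOf_seq_mem_compactum hM hr]
    exact h.isArithmeticCoding hM hr ht.2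
  · exact (bijOn_codingMap hM hr).injOn ht.1 ht'.1 (congrArg Prod.fst heq)
  · obtain ⟨t, ht, h1, h2⟩ := IsArithmeticCoding.exists_homoclinic hM hr hc
    exact ⟨t, ht, Prod.ext h1 h2.symm⟩

/-- Digits in the compactum are bounded, so all its sequences lie in the primary space. -/
theorem seq_image_compactum :
    PrimarySpace.seq '' {e : PrimarySpace M | e.seq ∈ compactum M} = compactum M := by
  refine Set.Subset.antisymm (by rintro _ ⟨e, he, rfl⟩; exact he) fun f hf => ?_
  have hadm := (mem_compactum_iff hM hr).1 hf
  exact ⟨⟨f, mem_primarySubmonoid_of_le (hM.one_lt_lam hr) hadm.le_zero⟩, hf, rfl⟩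

end main

end

end ToralCoding

theorem theorem1p2 (M : GL (Fin 2) ℤ) (hM : ToralCoding.IsHyperbolic M)
    (hr : 0 < ToralCoding.tr M) :
    -- (I) `t ↦ φ_t` is a bijection from the homoclinic points onto the continuous semigroup
    -- homomorphisms that turn the shift into `T`
    Set.BijOn (ToralCoding.codingMap M) {t | ToralCoding.IsHomoclinic M t}
      {φ | ToralCoding.IsEquivariantHom φ} ∧
    -- both series in the formula for `φ_t` converge, with sum `φ_t(ε)`
    (∀ t : ToralCoding.Torus, ToralCoding.IsHomoclinic M t →
      (∃! w : Fin 2 → ℝ, ToralCoding.IsPlanarCoordinates M t w) ∧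
      ∀ e : ToralCoding.PrimarySpace M,
        Filter.Tendsto (fun p : ℕ × ℕ => ∑ n ∈ Finset.Icc (-(p.1 : ℤ)) (p.2 : ℤ),
            e.seq n • ToralCoding.toralAut (M ^ (-n)) t)
          Filter.atTop (nhds (ToralCoding.codingMap M t e)) ∧
        ∀ w : Fin 2 → ℝ, ToralCoding.IsPlanarCoordinates M t w →
          Filter.Tendsto (fun p : ℕ × ℕ => ToralCoding.proj
              ((∑ n ∈ Finset.Icc (-(p.1 : ℤ)) (p.2 : ℤ),
                (e.seq n : ℝ) * ToralCoding.lam M ^ (-n)) • w))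
            Filter.atTop (nhds (ToralCoding.codingMap M t e))) ∧
    -- `φ_t` is surjective for `t ≠ 0`
    (∀ t : ToralCoding.Torus, ToralCoding.IsHomoclinic M t → t ≠ 0 →
      Function.Surjective (ToralCoding.codingMap M t)) ∧
    -- the arithmetic codings `(φ, X)` correspond bijectively to the nonzero homoclinic points
    Set.BijOn (fun t : ToralCoding.Torus =>
        (ToralCoding.codingMap M t,
          {e : ToralCoding.PrimarySpace M | e.seq ∈ ToralCoding.compactum M}))
      {t | ToralCoding.IsHomoclinic M t ∧ t ≠ 0}
      {c | ToralCoding.IsArithmeticCoding c.1 c.2} ∧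
    -- (II) in every coding `X` is the Markov compactum or the sofic compactum
    (∀ (φ : ToralCoding.PrimarySpace M → ToralCoding.Torus)
      (X : Set (ToralCoding.PrimarySpace M)), ToralCoding.IsArithmeticCoding φ X →
      (ToralCoding.dt M = -1 →
        ToralCoding.PrimarySpace.seq '' X = ToralCoding.markovCompactum (ToralCoding.tr M)) ∧
      (ToralCoding.dt M = 1 →
        ToralCoding.PrimarySpace.seq '' X = ToralCoding.soficCompactum (ToralCoding.tr M))) := by
  refine ⟨ToralCoding.bijOn_codingMap hM hr, fun t ht => ?_, fun t ht hne => ?_,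
    ToralCoding.bijOn_codingMap_compactum hM hr, fun φ X hX => ?_⟩
  · obtain ⟨w, s, h⟩ := ht.exists_isEigenRep hM hr
    refine ⟨ToralCoding.existsUnique_isPlanarCoordinates hM hr ht, fun e => ?_⟩
    have h1 := h.tendsto_sum hM hr e
    rw [← h.codingMap_eq hM hr] at h1
    refine ⟨h1, fun w' hw' => ?_⟩
    obtain rfl := (ToralCoding.existsUnique_isPlanarCoordinates hM hr ht).unique
      ⟨h.mulVec_w, h.proj_w⟩ hw'
    simpa only [h.sum_eq_proj hM hr] using h1
  · obtain ⟨w, s, h⟩ := ht.exists_isEigenRep hM hr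
    intro x
    obtain ⟨e, -, he⟩ : x ∈ ToralCoding.codingMap M t '' _ :=
      (h.image_admissible hM hr hne).symm ▸ Set.mem_univ x
    exact ⟨e, he⟩
  · obtain ⟨t, -, -, rfl⟩ := hX.exists_homoclinic hM hr
    rw [ToralCoding.seq_image_compactum hM hr, ToralCoding.compactum]
    exact ⟨fun hd => if_pos hd, fun hd => if_neg (by omega)⟩
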